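/- A simple gain graph $\Gamma$ with gains in $\mathbb{Z}$ consists of a finite vertex set $V_\Gamma$ and a finite set $E_\Gamma$ of classes $[i,j,g]$ of triples $(i,j,g)\in V_\Gamma\times V_\Gamma\times\mathbb{Z}$ with $i\neq j$, where $(i,j,g)\sim(j,i,-g)$. For an edge $e=[i,j,g]$, the deletion $\Gamma\setminus e$ is obtained by removing $e$ from the edge set, and the contraction $\Gamma/e$ has vertex set $V_\Gamma\setminus\{i\}$ and as edges the edges $[u,v,h]\in E_\Gamma$ with $u,v\neq i$ together with the classes $[k,j,h+g]$ for $[k,i,h]\in E_\Gamma$ with $k\neq i,j$. (The contraction depends on the chosen orientation $(i,j,g)$ of $e$, but the arrangement defined below does so only up to linear equivalence.) Let $q\in\mathbb{C}^{\times}$ not be a root of unity. The bias arrangement of $\Gamma$ is the arrangement in $\mathbb{C}^{V_\Gamma}$ $$\mathcal{B}(\Gamma)=\{\{x_i=0\} : i\in V_\Gamma\}\cup\{\{x_i-q^{g}x_j=0\} : [i,j,g]\in E_\Gamma\}.$$ For a central arrangement $\mathcal{A}$ in $\mathbb{C}^{V}$ with $S=\mathbb{C}[x_v : v\in V]$, let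 $D(\mathcal{A})$ be the module of derivations $\theta$ of $S$ over $\mathbb{C}$ with $\theta(\alpha_H)\in\alpha_H S$ for all $H\in\mathcal{A}$, where $\alpha_H$ is a linear form defining $H$. The arrangement $\mathcal{A}$ is free with exponents $\exp(\mathcal{A})=(d_1,\dots,d_n)$ (a multiset) if $D(\mathcal{A})\cong\bigoplus_{i} S(-d_i)$ as graded $S$-modules, that is, if $D(\mathcal{A})$ has an $S$-basis of homogeneous derivations of polynomial degrees $d_1,\dots,d_n$. The property that $\mathcal{B}(\Gamma)$ is inductively free along edges is defined recursively as the smallest property such that 1. if $E_\Gamma=\varnothing$, then $\mathcal{B}(\Gamma)$ is inductively free along edges; 2. if there is an edge $e\in E_\Gamma$ such that $\mathcal{B}(\Gamma\setminus e)$ and $\mathcal{B}(\Gamma/e)$ are inductively free along edges and free, with $\exp(\mathcal{B}(\Gamma/e))\subseteq\exp(\mathcal{B}(\Gamma\setminus e))$ as multisets, then $\mathcal{B}(\Gamma)$ is inductively free along edges. **Corollary 3.1.** Let $\ell\geq 1$ and $m\geq 0$ be integers, let $q\in\mathbb{C}^{\times}$ not be a root of unity, and let $\Gamma$ be the gain graph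 on $\{1,\dots,\ell\}$ whose edges are all $[i,j,g]$ with $i\neq j$ and $-m\leq g\leq m$. Then the arrangement in $\mathbb{C}^{\ell}$ determined by $$x_1\cdots x_\ell\prod_{\substack{1\leq i<j\leq\ell\\ -m\leq g\leq m}}(x_i-q^{g}x_j)$$ is equal to $\mathcal{B}(\Gamma)$, it is inductively free along edges, and it is free with exponents $(1,\,m\ell+2,\,m\ell+3,\,\dots,\,m\ell+\ell)$. -/

import Mathlib

/-- A simple gain graph on the vertex set `V` with gains in the (additively written) group `G`.
The edge set, a finite set of classes `[i, j, g] = [j, i, -g]` with `i ≠ j`, is encoded by the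
relation `Adj i j g`, meaning `[i, j, g] ∈ E`. -/
structure GainGraph (V : Type*) (G : Type*) [AddGroup G] where
  Adj : V → V → G → Prop
  ne_of_adj : ∀ {i j : V} {g : G}, Adj i j g → i ≠ j
  symm : ∀ {i j : V} {g : G}, Adj i j g → Adj j i (-g)
  finite_vertices : Finite V
  finite_edges : {e : V × V × G | Adj e.1 e.2.1 e.2.2}.Finite

namespace GainGraph

/-- The deletion `Γ ∖ [i, j, g]`. Both orientations of the edge are removed. -/
def delete {V G : Type*} [AddGroup G] (Γ : GainGraph V G) (i j : V) (g : G) : GainGraph V G where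
  Adj u v h := Γ.Adj u v h ∧ ¬(u = i ∧ v = j ∧ h = g) ∧ ¬(u = j ∧ v = i ∧ h = -g)
  ne_of_adj h := Γ.ne_of_adj h.1
  symm := by
    rintro u v h ⟨h₁, h₂, h₃⟩
    refine ⟨Γ.symm h₁, ?_, ?_⟩
    · rintro ⟨rfl, rfl, rfl⟩
      exact h₃ ⟨rfl, rfl, by simp⟩
    · rintro ⟨rfl, rfl, hh⟩
      exact h₂ ⟨rfl, rfl, neg_injective hh⟩
  finite_vertices := Γ.finite_vertices
  finite_edges := Γ.finite_edges.subset fun _ h => h.1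

/-- The adjacency relation of the contraction `Γ / (i, j, g)` on the vertex set `V ∖ {i}`. Its edges
are the edges `[u, v, h]` of `Γ` with `u, v ≠ i` and the classes `[k, j, h' + g]`, where `k ≠ i` and
`[k, i, h']` is an edge of `Γ`. As the graphs are simple, `k = j` contributes no edge. -/
def ContractAdj {V G : Type*} [AddGroup G] (Γ : GainGraph V G) (i j : V) (g : G)
    (u v : {w : V // w ≠ i}) (h : G) : Prop :=
  u ≠ v ∧
    (Γ.Adj u v h ∨
      (v.1 = j ∧ ∃ h' : G, Γ.Adj u i h' ∧ h = h' + g) ∨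
      (u.1 = j ∧ ∃ h' : G, Γ.Adj v i h' ∧ h = -(h' + g)))

/-- The contraction `Γ / (i, j, g)`. -/
def contract {V G : Type*} [AddGroup G] (Γ : GainGraph V G) (i j : V) (g : G) :
    GainGraph {w : V // w ≠ i} G where
  Adj := Γ.ContractAdj i j g
  ne_of_adj h := h.1
  symm := by
    rintro u v h ⟨huv, h₁ | ⟨hv, h', h₁, rfl⟩ | ⟨hu, h', h₁, rfl⟩⟩
    · exact ⟨huv.symm, Or.inl (Γ.symm h₁)⟩
    · exact ⟨huv.symm, Or.inr (Or.inr ⟨hv, h', h₁, rfl⟩)⟩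
    · exact ⟨huv.symm, Or.inr (Or.inl ⟨hu, h', h₁, by simp⟩)⟩
  finite_vertices := by
    have := Γ.finite_vertices
    infer_instance
  finite_edges := by
    have := Γ.finite_vertices
    have hG : {h : G | ∃ u v, Γ.Adj u v h}.Finite :=
      (Γ.finite_edges.image fun e => e.2.2).subset
        fun h ⟨u, v, huv⟩ => ⟨(u, v, h), huv, rfl⟩
    have hT := hG.union ((hG.image fun h => h + g).union (hG.image fun h => -(h + g)))
    refine ((Set.finite_univ (α := {w : V // w ≠ i})).prod
      ((Set.finite_univ (α := {w : V // w ≠ i})).prod hT)).subset ?_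
    rintro ⟨u, v, h⟩ ⟨-, h₁ | ⟨-, h', h₁, h₂⟩ | ⟨-, h', h₁, h₂⟩⟩
    · exact ⟨trivial, trivial, Or.inl ⟨_, _, h₁⟩⟩
    · exact ⟨trivial, trivial, Or.inr (Or.inl ⟨h', ⟨_, _, h₁⟩, h₂.symm⟩)⟩
    · exact ⟨trivial, trivial, Or.inr (Or.inr ⟨h', ⟨_, _, h₁⟩, h₂.symm⟩)⟩

/-- The bias arrangement `B(Γ)` in `ℂ ^ V`, as a set of hyperplanes. -/
def biasArrangement {V : Type*} (q : ℂ) (Γ : GainGraph V ℤ) : Set (Set (V → ℂ)) :=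
  {H | (∃ i : V, H = {x | x i = 0}) ∨
    ∃ (i j : V) (g : ℤ), Γ.Adj i j g ∧ H = {x | x i - q ^ g * x j = 0}}

end GainGraph

/-- The module `D(A)` of logarithmic derivations of a central arrangement `A` in `K ^ V`: the
derivations `θ` of the polynomial ring such that `α` divides `θ α` for every linear form `α`
that defines a hyperplane of `A`. -/
def logDerivations {K V : Type*} [Field K] (A : Set (Set (V → K))) :
    Submodule (MvPolynomial V K) (Derivation K (MvPolynomial V K) (MvPolynomial V K)) where
  carrier := {θ | ∀ H ∈ A, ∀ α : MvPolynomial V K, α.IsHomogeneous 1 →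
    H = {x | MvPolynomial.eval x α = 0} → α ∣ θ α}
  zero_mem' := fun _ _ _ _ _ => by simp
  add_mem' := fun h₁ h₂ H hH α hα hα' => by
    simpa using dvd_add (h₁ H hH α hα hα') (h₂ H hH α hα hα')
  smul_mem' := fun f θ h H hH α hα hα' => by
    simpa using (h H hH α hα hα').mul_left f

/-- The central arrangement `A` is free with exponents the multiset `d`: the module `D(A)` has a
basis of homogeneous derivations whose polynomial degrees are the elements of `d`, that is,
`D(A)` is isomorphic to the direct sum of the graded modules `S(-k)`, `k ∈ d`. -/
def IsFreeWithExponents {K V : Type*} [Field K] (A : Set (Set (V → K))) (d : Multiset ℕ) : Prop :=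
  ∃ (n : ℕ) (e : Fin n → ℕ) (b : Module.Basis (Fin n) (MvPolynomial V K) (logDerivations A)),
    (∀ (k : Fin n) (v : V), ((b k).1 (MvPolynomial.X v)).IsHomogeneous (e k)) ∧
      d = Finset.univ.val.map e

/-- `exp(A₁) ⊆ exp(A₂)` as multisets, for free arrangements `A₁`, `A₂`. -/
def ExponentsSubset {K V W : Type*} [Field K] (A₁ : Set (Set (V → K))) (A₂ : Set (Set (W → K))) :
    Prop :=
  ∃ d₁ d₂ : Multiset ℕ, IsFreeWithExponents A₁ d₁ ∧ IsFreeWithExponents A₂ d₂ ∧ d₁ ≤ d₂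

/-- The bias arrangement `B(Γ)` is inductively free along edges. -/
inductive BiasInductivelyFreeAlongEdges (q : ℂ) : ∀ {V : Type}, GainGraph V ℤ → Prop
  | of_no_edges {V : Type} (Γ : GainGraph V ℤ) (hΓ : ∀ i j g, ¬Γ.Adj i j g) :
      BiasInductivelyFreeAlongEdges q Γ
  | of_edge {V : Type} (Γ : GainGraph V ℤ) (i j : V) (g : ℤ) (he : Γ.Adj i j g)
      (hdel : BiasInductivelyFreeAlongEdges q (Γ.delete i j g))
      (hcon : BiasInductivelyFreeAlongEdges q (Γ.contract i j g))
      (hexp : ExponentsSubset ((Γ.contract i j g).biasArrangement q)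
        ((Γ.delete i j g).biasArrangement q)) :
      BiasInductivelyFreeAlongEdges q Γ

/-- The central arrangement determined by a polynomial `Q` that is a product of linear forms: the
hyperplanes `{α = 0}` for the nonzero linear forms `α` dividing `Q`. -/
def arrangementOfPolynomial {K V : Type*} [Field K] (Q : MvPolynomial V K) :
    Set (Set (V → K)) :=
  {H | ∃ α : MvPolynomial V K, α.IsHomogeneous 1 ∧ α ≠ 0 ∧ α ∣ Q ∧
    H = {x | MvPolynomial.eval x α = 0}}

/-- The gain graph on `ℓ` vertices with all the edges whose gain lies in `[-m, m]`. -/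
def catalanGainGraph (ℓ m : ℕ) : GainGraph (Fin ℓ) ℤ where
  Adj i j g := i ≠ j ∧ -(m : ℤ) ≤ g ∧ g ≤ m
  ne_of_adj h := h.1
  symm := fun ⟨h, h₁, h₂⟩ => ⟨h.symm, by omega, by omega⟩
  finite_vertices := inferInstance
  finite_edges := ((Set.finite_univ (α := Fin ℓ)).prod
    ((Set.finite_univ (α := Fin ℓ)).prod (Set.finite_Icc (-(m : ℤ)) m))).subset
      fun _ h => ⟨trivial, trivial, h.2⟩

/-- The polynomial `x₁ ⋯ x_ℓ ∏_{i < j, -m ≤ g ≤ m} (x_i - q ^ g x_j)`. -/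
noncomputable def fussCatalanPolynomial (q : ℂ) (ℓ m : ℕ) : MvPolynomial (Fin ℓ) ℂ :=
  (∏ i : Fin ℓ, MvPolynomial.X i) *
    ∏ i : Fin ℓ, ∏ j ∈ Finset.Ioi i, ∏ g ∈ Finset.Icc (-(m : ℤ)) m,
      (MvPolynomial.X i - MvPolynomial.C (q ^ g) * MvPolynomial.X j)

/-! The Catalan graph lies in a family of gain graphs that is stable under the deletions and
contractions needed. Give each vertex `v` an arc of length `L v` and join two nonempty arcs by the
gains `-L v < g < L u`, the offsets at which they overlap; all lengths `m + 1` give the Catalan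
graph. Lengthening arc `i` by one amounts to adding the edges `[i, v, L i]`, one for each other
nonempty arc `v`. Contracting such an edge appends arc `v` to arc `i` and yields an arc graph again,
whichever of these edges were added before.

For `n` vertices, `t ≥ 1` nonempty arcs and total length `s`, the exponents are `s, s - 1, ..., s -
t + 2` together with `n - t + 1` ones. Every contraction met while an arc is lengthened has `n - 1`
vertices, total length `s` and one arc fewer than the final graph, so its exponents `d` never
change. Each added edge raises the one remaining exponent by one, until it reaches `s + 1`.
Induction on `s` concludes (`arcGraph_inductivelyFree_and_free`).

Freeness at each edge is an addition theorem (`isFreeWithExponents_of_delete_contract`). A degree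
count produces a generator of the deletion, of degree at most the growing exponent, that is not
tangent to the new hyperplane. An explicit form `B` of at least that degree divides all restricted
values `θ α`. Hence the value at this generator is a constant times `B`, and the other generators
are made tangent by subtracting multiples of it. -/

section

open MvPolynomial

/-! ### Linear forms: divisibility, primality, zero loci -/

section LinearForms

variable {K V : Type*} [Field K]

/-- A polynomial is divisible by `X u - p` iff substituting `p` for `X u` kills it. -/
theorem X_sub_dvd_iff [DecidableEq V] (u : V) (p f : MvPolynomial V K)
    (hp : aeval (Function.update X u p) p = p) :
    (X u - p) ∣ f ↔ aeval (Function.update X u p) f = 0 := by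
  constructor
  · rintro ⟨g, rfl⟩
    rw [map_mul, map_sub, aeval_X, Function.update_self, hp, sub_self, zero_mul]
  · intro h
    have key : (Ideal.Quotient.mkₐ K (Ideal.span {X u - p})).comp
        (aeval (Function.update X u p)) = Ideal.Quotient.mkₐ K (Ideal.span {X u - p}) := by
      ext w
      by_cases hw : w = u
      · subst hw
        simp only [AlgHom.comp_apply, aeval_X, Function.update_self, Ideal.Quotient.mkₐ_eq_mk]
        rw [eq_comm, Ideal.Quotient.eq]
        exact Ideal.mem_span_singleton_self _
      · simp [hw]
    have := DFunLike.congr_fun key f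
    rw [AlgHom.comp_apply, h, map_zero, eq_comm, Ideal.Quotient.mkₐ_eq_mk,
      Ideal.Quotient.eq_zero_iff_mem] at this
    exact Ideal.mem_span_singleton.mp this

theorem aeval_update_C_mul_X [DecidableEq V] {u v : V} (huv : u ≠ v) (c : K) :
    aeval (Function.update X u (C c * X v)) (C c * X v : MvPolynomial V K) = C c * X v := by
  simp [huv.symm, algebraMap_eq]

/-- Divisibility by the form is vanishing under a substitution, a homomorphism into a domain. -/
theorem prime_X_sub_C_mul_X {u v : V} (huv : u ≠ v) (c : K) :
    Prime (X u - C c * X v : MvPolynomial V K) := by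
  classical
  have h := fun f => X_sub_dvd_iff (K := K) u (C c * X v) f (aeval_update_C_mul_X huv c)
  refine ⟨fun h0 => ?_, fun hu => ?_, fun a b hab => ?_⟩
  · have := congrArg (eval (Pi.single u (1 : K))) h0
    simp [huv.symm] at this
  · have := (h 1).mp hu.dvd
    simp at this
  · rw [h, map_mul, mul_eq_zero] at hab
    rwa [h, h]

theorem isHomogeneous_X_sub_C_mul_X (u v : V) (c : K) :
    (X u - C c * X v : MvPolynomial V K).IsHomogeneous 1 :=
  (isHomogeneous_X K u).sub (isHomogeneous_C_mul_X c v)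

theorem eval_add_smul {α : MvPolynomial V K} (hα : α.IsHomogeneous 1) (x y : V → K) (t : K) :
    eval (x + t • y) α = eval x α + t * eval y α := by
  have h : α ∈ Submodule.span K (Set.range X) := by
    rw [← homogeneousSubmodule_one_eq_span_X]; exact hα
  clear hα
  induction h using Submodule.span_induction with
  | mem _ h => obtain ⟨v, rfl⟩ := h; simp
  | zero => simp
  | add a b _ _ ha hb =>
    simp only [map_add]
    rw [ha, hb]
    ring
  | smul c a _ ha =>
    simp only [smul_eval]
    rw [ha]
    ring

/-- A linear form vanishing wherever `β` does is a multiple of `β`. -/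
theorem eq_C_mul_of_eval_eq_zero [Infinite K] {α β : MvPolynomial V K}
    (hα : α.IsHomogeneous 1) (hβ : β.IsHomogeneous 1) {z : V → K} (hz : eval z β = 1)
    (h : ∀ x, eval x β = 0 → eval x α = 0) : α = C (eval z α) * β := by
  refine MvPolynomial.funext fun x => ?_
  have h1 := h (x + (-eval x β) • z) (by rw [eval_add_smul hβ, hz]; ring)
  rw [eval_add_smul hα] at h1
  rw [map_mul, eval_C]
  linear_combination h1

theorem exists_eq_C_mul_of_zeroLocus_eq [Infinite K] {α β : MvPolynomial V K}
    (hα : α.IsHomogeneous 1) (hβ : β.IsHomogeneous 1) {z : V → K} (hz : eval z β = 1)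
    (h : {x | eval x β = 0} = {x | eval x α = 0}) : ∃ c : K, c ≠ 0 ∧ α = C c * β := by
  refine ⟨_, fun h0 => ?_, eq_C_mul_of_eval_eq_zero hα hβ hz fun x hx =>
    (Set.ext_iff.mp h x).mp hx⟩
  have : eval z β = 0 := (Set.ext_iff.mp h z).mpr h0
  simp [hz] at this

theorem C_mul_dvd_apply_iff {c : K} (hc : c ≠ 0)
    (θ : Derivation K (MvPolynomial V K) (MvPolynomial V K)) (β : MvPolynomial V K) :
    C c * β ∣ θ (C c * β) ↔ β ∣ θ β := by
  have hu : IsUnit (C c : MvPolynomial V K) := (IsUnit.mk0 c hc).map C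
  rw [← smul_eq_C_mul, Derivation.map_smul, smul_eq_C_mul, smul_eq_C_mul, hu.mul_left_dvd,
    hu.dvd_mul_left]

end LinearForms

/-! ### Logarithmic derivations of a bias arrangement -/

namespace GainGraph

variable {V : Type*} {q : ℂ}

/-- A hyperplane determines its linear form up to a nonzero scalar, so testing one form for each
suffices. -/
theorem mem_logDerivations_biasArrangement (Γ : GainGraph V ℤ)
    (θ : Derivation ℂ (MvPolynomial V ℂ) (MvPolynomial V ℂ)) :
    θ ∈ logDerivations (Γ.biasArrangement q) ↔ (∀ i, X i ∣ θ (X i)) ∧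
      ∀ i j g, Γ.Adj i j g → (X i - C (q ^ g) * X j) ∣ θ (X i - C (q ^ g) * X j) := by
  classical
  constructor
  · intro h
    refine ⟨fun i => h _ (Or.inl ⟨i, rfl⟩) _ (isHomogeneous_X _ _) (by simp), fun i j g hg =>
      h _ (Or.inr ⟨i, j, g, hg, rfl⟩) _ (isHomogeneous_X_sub_C_mul_X _ _ _) (by simp)⟩
  · rintro ⟨h1, h2⟩ H (⟨i, rfl⟩ | ⟨i, j, g, hg, rfl⟩) α hα hH
    · obtain ⟨c, hc, rfl⟩ := exists_eq_C_mul_of_zeroLocus_eq hα (isHomogeneous_X ℂ i)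
        (z := Pi.single i 1) (by simp) (by simpa using hH)
      exact (C_mul_dvd_apply_iff hc _ _).mpr (h1 i)
    · obtain ⟨c, hc, rfl⟩ := exists_eq_C_mul_of_zeroLocus_eq hα
        (isHomogeneous_X_sub_C_mul_X i j (q ^ g)) (z := Pi.single i 1)
        (by simp [(Γ.ne_of_adj hg).symm]) (by simpa using hH)
      exact (C_mul_dvd_apply_iff hc _ _).mpr (h2 i j g hg)

end GainGraph

/-! ### The arrangement of the defining polynomial -/

section ProductOfForms

/-- A nonzero linear form is prime, so it divides one of the linear factors and, by degree, is
proportional to it. Edges with `i > j` are reversed, which preserves the symmetric range of gains.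
-/
theorem arrangementOfPolynomial_fussCatalanPolynomial (ℓ m : ℕ) {q : ℂ} (hq : q ≠ 0) :
    arrangementOfPolynomial (fussCatalanPolynomial q ℓ m) =
      (catalanGainGraph ℓ m).biasArrangement q := by
  have hassoc : ∀ {α β : MvPolynomial (Fin ℓ) ℂ}, α.IsHomogeneous 1 → α ≠ 0 → Prime β →
      β.IsHomogeneous 1 → α ∣ β → {x | eval x α = 0} = {x | eval x β = 0} := by
    rintro α β hα h0 hβ hβ1 ⟨c, rfl⟩
    have hc0 : c ≠ 0 := by rintro rfl; simp at hβ
    have hdeg := totalDegree_mul_of_isDomain h0 hc0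
    rw [hβ1.totalDegree hβ.ne_zero, hα.totalDegree h0] at hdeg
    obtain ⟨a, rfl⟩ : ∃ a, c = C a := ⟨_, totalDegree_eq_zero_iff_eq_C.mp (by omega)⟩
    have ha : a ≠ 0 := by rintro rfl; simp at hc0
    simp [ha]
  ext H
  constructor
  · rintro ⟨α, hα, h0, hdvd, rfl⟩
    have hα1 : α.totalDegree = 1 := hα.totalDegree h0
    have hirr : Prime α := by
      refine (irreducible_of_totalDegree_eq_one hα1 fun x hx => ?_).prime
      obtain ⟨d, hd⟩ := ne_zero_iff.mp h0
      refine IsUnit.mk0 x fun hx0 => hd ?_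
      simpa [hx0] using hx d
    rw [fussCatalanPolynomial] at hdvd
    rcases hirr.dvd_or_dvd hdvd with h | h
    · obtain ⟨i, -, hi⟩ := hirr.exists_mem_finset_dvd h
      refine Or.inl ⟨i, ?_⟩
      rw [hassoc hα h0 (X_prime) (isHomogeneous_X _ _) hi]
      simp
    · obtain ⟨i, -, hi⟩ := hirr.exists_mem_finset_dvd h
      obtain ⟨j, hj, hij⟩ := hirr.exists_mem_finset_dvd hi
      obtain ⟨g, hg, hgg⟩ := hirr.exists_mem_finset_dvd hij
      have hne : i ≠ j := (Finset.mem_Ioi.mp hj).ne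
      refine Or.inr ⟨i, j, g, ⟨hne, Finset.mem_Icc.mp hg⟩, ?_⟩
      rw [hassoc hα h0 (prime_X_sub_C_mul_X hne _) (isHomogeneous_X_sub_C_mul_X _ _ _) hgg]
      simp
  · have hmem : ∀ i j : Fin ℓ, ∀ g : ℤ, i < j → -(m : ℤ) ≤ g → g ≤ m →
        {x : Fin ℓ → ℂ | x i - q ^ g * x j = 0} ∈
          arrangementOfPolynomial (fussCatalanPolynomial q ℓ m) := by
      intro i j g hij h1 h2
      refine ⟨X i - C (q ^ g) * X j, isHomogeneous_X_sub_C_mul_X _ _ _,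
        (prime_X_sub_C_mul_X hij.ne _).ne_zero, ?_, by simp⟩
      rw [fussCatalanPolynomial]
      refine Dvd.dvd.mul_left ?_ _
      refine dvd_trans ?_ (Finset.dvd_prod_of_mem _ (Finset.mem_univ i))
      refine dvd_trans ?_ (Finset.dvd_prod_of_mem _ (Finset.mem_Ioi.mpr hij))
      exact Finset.dvd_prod_of_mem (fun g => (X i - C (q ^ g) * X j : MvPolynomial (Fin ℓ) ℂ))
        (Finset.mem_Icc.mpr ⟨h1, h2⟩)
    rintro (⟨i, rfl⟩ | ⟨i, j, g, ⟨hne, h1, h2⟩, rfl⟩)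
    · refine ⟨X i, isHomogeneous_X _ _, X_ne_zero _, ?_, by simp⟩
      exact (Finset.dvd_prod_of_mem _ (Finset.mem_univ i)).mul_right _
    · rcases lt_or_gt_of_ne hne with h | h
      · exact hmem i j g h h1 h2
      · convert hmem j i (-g) h (by omega) (by omega) using 1
        ext x
        have hg : q ^ g ≠ 0 := zpow_ne_zero _ hq
        simp only [Set.mem_ofPred_eq, zpow_neg]
        constructor <;> intro hx
        · field_simp
          linear_combination -hx
        · field_simp at hx
          linear_combination -hx

end ProductOfForms

/-! ### Homogeneous derivations and their coordinates -/

section Graded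

variable {K V : Type*} [Field K]

theorem derivation_sum_apply {ι : Type*} (s : Finset ι)
    (θ : ι → Derivation K (MvPolynomial V K) (MvPolynomial V K)) (f : MvPolynomial V K) :
    (∑ k ∈ s, θ k) f = ∑ k ∈ s, θ k f := by
  rw [← Derivation.coeFnAddMonoidHom_apply, map_sum, Finset.sum_apply]
  rfl

theorem homogeneousComponent_mul_of_isHomogeneous_right (p : MvPolynomial V K)
    {f : MvPolynomial V K} {e : ℕ} (hf : f.IsHomogeneous e) (d : ℕ) :
    homogeneousComponent d (p * f) = if e ≤ d then homogeneousComponent (d - e) p * f else 0 := by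
  let _ := MvPolynomial.gradedAlgebra (σ := V) (R := K)
  have h := DirectSum.coe_decompose_mul_of_right_mem (homogeneousSubmodule V K) d (a := p) hf
  have hd (r : MvPolynomial V K) (n : ℕ) :
      (DirectSum.decompose (homogeneousSubmodule V K) r n : MvPolynomial V K) =
        homogeneousComponent n r := MvPolynomial.decomposition.decompose'_apply r n
  simpa only [hd] using h

/-- A derivation of the polynomial ring is homogeneous of polynomial degree `d`. -/
def IsHomogeneousDerivation (θ : Derivation K (MvPolynomial V K) (MvPolynomial V K)) (d : ℕ) :
    Prop :=
  ∀ v, (θ (X v)).IsHomogeneous d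

theorem IsHomogeneousDerivation.apply_linear_form
    {θ : Derivation K (MvPolynomial V K) (MvPolynomial V K)} {d : ℕ}
    (h : IsHomogeneousDerivation θ d) (u v : V) (c : K) :
    (θ (X u - C c * X v)).IsHomogeneous d := by
  have : θ (X u - C c * X v) = θ (X u) - C c * θ (X v) := by simp
  rw [this]
  exact (h u).sub ((h v).C_mul c)

/-- Replacing each coordinate by its component of degree `d - e k` still represents `ψ`, so by
uniqueness nothing else occurs; for `d < e l` there is no such component. -/
theorem repr_eq_zero_of_isHomogeneousDerivation {ι : Type*} [Fintype ι]
    {M : Submodule (MvPolynomial V K) (Derivation K (MvPolynomial V K) (MvPolynomial V K))}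
    (b : Module.Basis ι (MvPolynomial V K) M) {e : ι → ℕ}
    (hb : ∀ k, IsHomogeneousDerivation (b k).1 (e k)) (ψ : M) {d : ℕ}
    (hψ : IsHomogeneousDerivation ψ.1 d) {l : ι} (hl : d < e l) : b.repr ψ l = 0 := by
  set c : ι → MvPolynomial V K := fun k =>
    if e k ≤ d then homogeneousComponent (d - e k) (b.repr ψ k) else 0 with hc
  have key : ∑ k, c k • b k = ψ := by
    apply Subtype.ext
    refine derivation_ext fun v => ?_
    have h1 : ψ.1 (X v) = ∑ k, b.repr ψ k * (b k).1 (X v) := by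
      conv_lhs => rw [← b.sum_repr ψ]
      simp only [AddSubmonoidClass.coe_finsetSum, Submodule.coe_smul, derivation_sum_apply,
        Derivation.smul_apply, smul_eq_mul]
    have h2 := homogeneousComponent_of_mem (m := d) (hψ v)
    rw [if_pos rfl, h1, map_sum] at h2
    rw [h1, ← h2]
    simp only [AddSubmonoidClass.coe_finsetSum, Submodule.coe_smul, derivation_sum_apply,
      Derivation.smul_apply, smul_eq_mul]
    refine Finset.sum_congr rfl fun k _ => ?_
    rw [homogeneousComponent_mul_of_isHomogeneous_right _ (hb k v), hc]
    dsimp only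
    split_ifs <;> simp
  rw [← key, b.repr_sum_self, hc]
  simp [not_le.mpr hl]

end Graded

/-! ### Restriction to a hyperplane -/

section Restriction

variable {K V : Type*} [Field K] {i j : V} (hij : i ≠ j) (c : K)

open Classical in
/-- The restriction of polynomials to the hyperplane `x i = c x j`. -/
noncomputable def restrictHom : MvPolynomial V K →ₐ[K] MvPolynomial {w : V // w ≠ i} K :=
  aeval fun w => if h : w = i then C c * X ⟨j, hij.symm⟩ else X ⟨w, h⟩

@[simp] theorem restrictHom_X_self : restrictHom hij c (X i) = C c * X ⟨j, hij.symm⟩ := by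
  simp [restrictHom]

theorem restrictHom_X_of_ne {w : V} (h : w ≠ i) : restrictHom hij c (X w) = X ⟨w, h⟩ := by
  simp [restrictHom, h]

@[simp] theorem restrictHom_X_val (w : {w : V // w ≠ i}) : restrictHom hij c (X w.1) = X w :=
  restrictHom_X_of_ne hij c w.2

@[simp] theorem restrictHom_C (a : K) : restrictHom hij c (C a) = C a := by
  rw [← algebraMap_eq, AlgHom.commutes, algebraMap_eq]

@[simp] theorem restrictHom_rename (f : MvPolynomial {w : V // w ≠ i} K) :
    restrictHom hij c (rename Subtype.val f) = f := by
  have : (restrictHom hij c).comp (rename Subtype.val) = AlgHom.id K _ := by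
    ext w
    simp
  exact DFunLike.congr_fun this f

theorem dvd_iff_restrictHom_eq_zero (f : MvPolynomial V K) :
    (X i - C c * X j) ∣ f ↔ restrictHom hij c f = 0 := by
  classical
  rw [X_sub_dvd_iff _ _ _ (aeval_update_C_mul_X hij c)]
  have : (aeval (Function.update X i (C c * X j : MvPolynomial V K))) =
      (rename Subtype.val).comp (restrictHom hij c) := by
    ext w
    by_cases h : w = i
    · subst h; simp
    · simp [h, restrictHom_X_of_ne]
  rw [this, AlgHom.comp_apply]
  exact map_eq_zero_iff _ (rename_injective _ Subtype.val_injective)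

theorem restrictHom_eq_iff (f g : MvPolynomial V K) :
    restrictHom hij c f = restrictHom hij c g ↔ (X i - C c * X j) ∣ f - g := by
  rw [dvd_iff_restrictHom_eq_zero hij, map_sub, sub_eq_zero]

theorem isHomogeneous_restrictHom {f : MvPolynomial V K} {d : ℕ} (hf : f.IsHomogeneous d) :
    (restrictHom hij c f).IsHomogeneous d := by
  classical
  have := hf.aeval (φ := f)
    (fun w => if h : w = i then C c * X ⟨j, hij.symm⟩ else X ⟨w, h⟩ :
      V → MvPolynomial {w : V // w ≠ i} K)
    (n := 1) fun w => by
      split_ifs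
      · exact isHomogeneous_C_mul_X _ _
      · exact isHomogeneous_X _ _
  rw [one_mul] at this
  rwa [restrictHom]

/-- The derivation of the polynomial ring of the hyperplane `x i = c x j` induced by `θ`. -/
noncomputable def restrictDerivation (θ : Derivation K (MvPolynomial V K) (MvPolynomial V K)) :
    Derivation K (MvPolynomial {w : V // w ≠ i} K) (MvPolynomial {w : V // w ≠ i} K) :=
  mkDerivation K fun w => restrictHom hij c (θ (X w.1))

@[simp] theorem restrictDerivation_X
    (θ : Derivation K (MvPolynomial V K) (MvPolynomial V K)) (w : {w : V // w ≠ i}) :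
    restrictDerivation hij c θ (X w) = restrictHom hij c (θ (X w.1)) :=
  mkDerivation_X _ _ _

/-- A tangent derivation preserves the ideal of the hyperplane and so descends to the quotient; only
the eliminated variable `X i` needs tangency. -/
theorem restrictDerivation_restrictHom
    {θ : Derivation K (MvPolynomial V K) (MvPolynomial V K)}
    (hθ : (X i - C c * X j) ∣ θ (X i - C c * X j)) (f : MvPolynomial V K) :
    restrictDerivation hij c θ (restrictHom hij c f) = restrictHom hij c (θ f) := by
  rw [dvd_iff_restrictHom_eq_zero hij] at hθ
  induction f using MvPolynomial.induction_on with
  | C a => simp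
  | add p r hp hr => simp [hp, hr]
  | mul_X p w hp =>
    have hw : restrictDerivation hij c θ (restrictHom hij c (X w)) =
        restrictHom hij c (θ (X w)) := by
      by_cases h : w = i
      · subst h
        simp only [map_sub, Derivation.leibniz, derivation_C, smul_eq_mul, mul_zero, add_zero,
          map_mul, restrictHom_C] at hθ
        rw [restrictHom_X_self]
        simp only [Derivation.leibniz, derivation_C, smul_eq_mul, mul_zero, add_zero,
          restrictDerivation_X]
        linear_combination -hθ
      · rw [restrictHom_X_of_ne hij c h, restrictDerivation_X]
    simp [hp, hw]

theorem restrictDerivation_sum_smul {ι : Type*} (s : Finset ι) (f : ι → MvPolynomial V K)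
    (θ : ι → Derivation K (MvPolynomial V K) (MvPolynomial V K)) :
    restrictDerivation hij c (∑ k ∈ s, f k • θ k) =
      ∑ k ∈ s, restrictHom hij c (f k) • restrictDerivation hij c (θ k) := by
  refine derivation_ext fun w => ?_
  simp [derivation_sum_apply]

theorem exists_eq_smul_of_restrictDerivation_eq_zero
    {θ : Derivation K (MvPolynomial V K) (MvPolynomial V K)}
    (hθ : (X i - C c * X j) ∣ θ (X i - C c * X j)) (h : restrictDerivation hij c θ = 0) :
    ∃ η : Derivation K (MvPolynomial V K) (MvPolynomial V K),
      θ = (X i - C c * X j : MvPolynomial V K) • η := by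
  have hdvd : ∀ w, (X i - C c * X j) ∣ θ (X w) := fun w => by
    rw [dvd_iff_restrictHom_eq_zero hij, ← restrictDerivation_restrictHom hij c hθ, h]
    simp
  choose η hη using hdvd
  exact ⟨mkDerivation K η, derivation_ext fun w => by simp [hη w, mkDerivation_X]⟩

end Restriction

/-! ### The addition theorem for modules of derivations -/

section Addition

theorem exists_basis_of_existsUnique {R M ι : Type*} [Semiring R] [AddCommMonoid M] [Module R M]
    [Fintype ι] (θ : ι → M) (h : ∀ x, ∃! g : ι → R, ∑ l, g l • θ l = x) :
    ∃ b : Module.Basis ι R M, ⇑b = θ := by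
  have hbij : Function.Bijective (Fintype.linearCombination R θ) := by
    refine ⟨fun g g' hg => ?_, fun x => ?_⟩
    · simp only [Fintype.linearCombination_apply] at hg
      exact (h _).unique hg rfl
    · obtain ⟨g, hg, -⟩ := h x
      exact ⟨g, by rw [Fintype.linearCombination_apply]; exact hg⟩
  classical
  refine ⟨Module.Basis.ofEquivFun (LinearEquiv.ofBijective _ hbij).symm, ?_⟩
  ext l
  simp [Fintype.linearCombination_apply]


variable {K V : Type*} [Field K] {i j : V} (hij : i ≠ j) (c : K)
  {D' D : Submodule (MvPolynomial V K) (Derivation K (MvPolynomial V K) (MvPolynomial V K))}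
  {D'' : Submodule (MvPolynomial {w : V // w ≠ i} K)
    (Derivation K (MvPolynomial {w : V // w ≠ i} K) (MvPolynomial {w : V // w ≠ i} K))}

/-- If `D''` has one generator of degree at most `a` less than `D'`, then the generators of `D'`
of degree at most `a` cannot all be tangent to the hyperplane. -/
theorem exists_generator_not_tangent
    (hD : ∀ θ, θ ∈ D ↔ θ ∈ D' ∧ (X i - C c * X j) ∣ θ (X i - C c * X j))
    (hres : ∀ θ ∈ D, restrictDerivation hij c θ ∈ D'')
    (hsat : ∀ η, (X i - C c * X j : MvPolynomial V K) • η ∈ D' → η ∈ D')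
    {ι κ : Type*} [Fintype ι] [Fintype κ] (b : Module.Basis ι (MvPolynomial V K) D') {e : ι → ℕ}
    (hb : ∀ k, IsHomogeneousDerivation (b k).1 (e k))
    (b' : Module.Basis κ (MvPolynomial {w : V // w ≠ i} K) D'') {e' : κ → ℕ}
    (hb' : ∀ k, IsHomogeneousDerivation (b' k).1 (e' k)) {a : ℕ}
    (hcard : Fintype.card {l // e' l ≤ a} < Fintype.card {k // e k ≤ a}) :
    ∃ k, e k ≤ a ∧ ¬ (X i - C c * X j) ∣ (b k).1 (X i - C c * X j) := by
  by_contra! hcon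
  have hmem : ∀ k : {k // e k ≤ a}, (b k.1).1 ∈ D := fun k =>
    (hD _).mpr ⟨(b k.1).2, hcon k.1 k.2⟩
  let ρ : {k // e k ≤ a} → D'' := fun k => ⟨_, hres _ (hmem k)⟩
  have hρ : ∀ k, IsHomogeneousDerivation (ρ k).1 (e k.1) := fun k v => by
    simp only [ρ, restrictDerivation_X]
    exact isHomogeneous_restrictHom hij c (hb _ _)
  -- By degree, the restrictions lie in the span of the generators of `D''` of degree at most `a`.
  -- There are too few of these, so the restrictions are linearly dependent.
  have hzero : ∀ k l, a < e' l → b'.repr (ρ k) l = 0 := fun k l hl =>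
    repr_eq_zero_of_isHomogeneousDerivation b' hb' _ (hρ k) (k.2.trans_lt hl)
  let M : Matrix {l // e' l ≤ a} {k // e k ≤ a} (MvPolynomial {w : V // w ≠ i} K) :=
    fun l k => b'.repr (ρ k) l.1
  have hninj : ¬ Function.Injective M.mulVecLin := fun h =>
    hcard.not_ge (card_le_of_injective _ _ h)
  rw [← LinearMap.ker_eq_bot, ← ne_eq, Submodule.ne_bot_iff] at hninj
  obtain ⟨v, hv, hv0⟩ := hninj
  have hsum : ∑ k, v k • ρ k = 0 := by
    apply b'.repr.injective
    ext1 l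
    rw [map_zero, map_sum, Finsupp.finsetSum_apply]
    by_cases hl : e' l ≤ a
    · have h1 : M.mulVec v ⟨l, hl⟩ = 0 := congrFun hv ⟨l, hl⟩
      rw [Matrix.mulVec, dotProduct] at h1
      refine (Finset.sum_congr rfl fun k _ => ?_).trans h1
      rw [map_smul, Finsupp.smul_apply, smul_eq_mul, mul_comm]
    · exact Finset.sum_eq_zero fun k _ => by simp [hzero k l (not_le.mp hl)]
  -- The dependency is lifted to coefficients free of `X i`. The lifted combination restricts to
  -- zero, hence is the linear form times an element of `D'`; comparing coordinates, each
  -- coefficient is divisible by the form, so its restriction `v k` vanishes.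
  set f : ι → MvPolynomial V K := fun k => if h : e k ≤ a then rename Subtype.val (v ⟨k, h⟩) else 0
    with hf
  have hθD : ∑ k, f k • (b k).1 ∈ D := Submodule.sum_mem _ fun k _ => by
    by_cases h : e k ≤ a
    · exact D.smul_mem _ (hmem ⟨k, h⟩)
    · simp [hf, h]
  have hθ0 : restrictDerivation hij c (∑ k, f k • (b k).1) = 0 := by
    rw [restrictDerivation_sum_smul]
    have h2 := congrArg Subtype.val hsum
    simp only [AddSubmonoidClass.coe_finsetSum, Submodule.coe_smul, Submodule.coe_zero, ρ] at h2
    rw [← h2]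
    classical
    rw [← Finset.sum_subset (Finset.subset_univ (Finset.univ.filter fun k => e k ≤ a)),
      ← Finset.sum_subtype_eq_sum_filter, Finset.subtype_univ]
    · refine Finset.sum_congr rfl fun k _ => ?_
      simp [hf, k.2]
    · intro k _ hk
      simp at hk
      simp [hf, hk.not_ge]
  obtain ⟨η, hη⟩ := exists_eq_smul_of_restrictDerivation_eq_zero hij c ((hD _).mp hθD).2 hθ0
  have hηD : η ∈ D' := hsat η (hη ▸ ((hD _).mp hθD).1)
  have hcoord : ∑ k, f k • b k = (X i - C c * X j : MvPolynomial V K) • (⟨η, hηD⟩ : D') := by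
    apply Subtype.ext
    simpa using hη
  refine hv0 (funext fun k => ?_)
  have h3 := congrArg (fun θ => b.repr θ k.1) hcoord
  simp only [b.repr_sum_self, map_smul, Finsupp.smul_apply, smul_eq_mul] at h3
  have h4 := (dvd_iff_restrictHom_eq_zero hij c (f k.1)).mp ⟨_, h3⟩
  simpa [hf, k.2] using h4

/-- The addition step for modules of derivations: the generator `b k` becomes tangent to the
hyperplane after multiplication by the linear form, the others after subtracting a multiple of
`b k`. -/
theorem exists_basis_of_addition (hij : i ≠ j) (c : K)
    (hD : ∀ θ, θ ∈ D ↔ θ ∈ D' ∧ (X i - C c * X j) ∣ θ (X i - C c * X j))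
    {n : ℕ} (b : Module.Basis (Fin n) (MvPolynomial V K) D')
    {e : Fin n → ℕ} (hb : ∀ k, IsHomogeneousDerivation (b k).1 (e k)) {k : Fin n}
    (hk : ¬ (X i - C c * X j) ∣ (b k).1 (X i - C c * X j))
    {f : Fin n → MvPolynomial V K}
    (hf : ∀ l, (X i - C c * X j) ∣
      (b l).1 (X i - C c * X j) - f l * (b k).1 (X i - C c * X j))
    (hfdeg : ∀ l v, (f l * (b k).1 (X v)).IsHomogeneous (e l)) :
    ∃ b₁ : Module.Basis (Fin n) (MvPolynomial V K) D,
      ∀ l, IsHomogeneousDerivation (b₁ l).1 (Function.update e k (e k + 1) l) := by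
  set α : MvPolynomial V K := X i - C c * X j with hα
  have hprime : Prime α := prime_X_sub_C_mul_X hij c
  have hα1 : α.IsHomogeneous 1 := isHomogeneous_X_sub_C_mul_X i j c
  -- The value `α - 1` at `k` lets `b l + f' l • b k` describe all new generators at once: it is `α
  -- • b k` for `l = k`.
  set f' : Fin n → MvPolynomial V K := Function.update (-f) k (α - 1) with hf'
  have hmem : ∀ l, ((b l + f' l • b k : D') : Derivation K _ _) ∈ D := fun l => by
    refine (hD _).mpr ⟨Subtype.property _, ?_⟩
    by_cases hl : l = k
    · subst hl
      refine ⟨(b l).1 α, ?_⟩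
      simp only [hf', Function.update_self, Submodule.coe_add, Submodule.coe_smul,
        Derivation.add_apply, Derivation.smul_apply, smul_eq_mul]
      ring
    · simpa [hf', hl, sub_eq_add_neg] using hf l
  let θ : Fin n → D := fun l => ⟨_, hmem l⟩
  have hcoord : ∀ (g : Fin n → MvPolynomial V K) (x : D),
      ∑ l, g l • θ l = x ↔ ∀ l, b.repr ⟨x.1, ((hD _).mp x.2).1⟩ l =
        g l + if l = k then ∑ m, g m * f' m else 0 := fun g x => by
    have h1 : ∑ l, g l • θ l = x ↔
        ∑ l, g l • (b l + f' l • b k) = ⟨x.1, ((hD _).mp x.2).1⟩ := by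
      rw [Subtype.ext_iff, Subtype.ext_iff]
      simp [θ]
    have h2 : ∑ l, g l • (b l + f' l • b k) =
        ∑ l, (g l + if l = k then ∑ m, g m * f' m else 0) • b l := by
      simp only [smul_add, add_smul, Finset.sum_add_distrib, smul_smul, ite_smul, zero_smul,
        Finset.sum_ite_eq', Finset.mem_univ, if_true, Finset.sum_smul]
    rw [h1, h2, ← b.repr.injective.eq_iff, DFunLike.ext_iff]
    simp only [b.repr_sum_self]
    exact forall_congr' fun l => eq_comm
  obtain ⟨b₁, hb₁⟩ := exists_basis_of_existsUnique θ fun x => by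
    set r := b.repr ⟨x.1, ((hD _).mp x.2).1⟩ with hr
    -- Modulo `α`, each `b l α` is `f l * b k α`. As `α` is prime and does not divide `b k α`, it
    -- divides the first factor, and the quotient is the new `k`-th coordinate.
    have hdvd : α ∣ (r k + ∑ l ∈ Finset.univ.erase k, r l * f l) * (b k).1 α := by
      have h1 : x.1 = ∑ l, r l • (b l).1 := by
        have := congrArg Subtype.val (b.sum_repr ⟨x.1, ((hD _).mp x.2).1⟩)
        simpa only [AddSubmonoidClass.coe_finsetSum, Submodule.coe_smul] using this.symm
      have h2 := ((hD _).mp x.2).2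
      rw [h1, derivation_sum_apply, ← Finset.add_sum_erase _ _ (Finset.mem_univ k)] at h2
      have h3 : α ∣ ∑ l ∈ Finset.univ.erase k, r l * ((b l).1 α - f l * (b k).1 α) :=
        Finset.dvd_sum fun l _ => (hf l).mul_left _
      convert dvd_sub h2 h3 using 1
      simp only [Derivation.smul_apply, smul_eq_mul, mul_sub, Finset.sum_sub_distrib]
      rw [add_mul, Finset.sum_mul]
      simp only [mul_assoc]
      ring
    obtain ⟨h, hh⟩ := (hprime.dvd_or_dvd hdvd).resolve_right hk
    have hsum : ∀ g : Fin n → MvPolynomial V K, (∀ l, l ≠ k → g l = r l) →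
        g k + ∑ m, g m * f' m = α * g k - ∑ l ∈ Finset.univ.erase k, r l * f l := by
      intro g hg
      rw [← Finset.add_sum_erase _ _ (Finset.mem_univ k),
        Finset.sum_congr rfl (g := fun m => -(r m * f m)), Finset.sum_neg_distrib]
      · simp only [hf', Function.update_self]
        ring
      · intro m hm
        simp [hf', Finset.ne_of_mem_erase hm, hg m (Finset.ne_of_mem_erase hm)]
    refine ⟨Function.update r k h, (hcoord _ x).mpr fun l => ?_, fun g hg => ?_⟩
    · by_cases hl : l = k
      · subst hl
        rw [if_pos rfl, hsum _ fun m hm => Function.update_of_ne hm _ _, Function.update_self]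
        linear_combination hh
      · simp [hl, hr]
    · have h1 := (hcoord g x).mp hg
      have h2 : ∀ l, l ≠ k → g l = r l := fun l hl => by
        rw [hr, h1 l, if_neg hl, add_zero]
      funext l
      by_cases hl : l = k
      · subst hl
        have h3 := h1 l
        rw [if_pos rfl, hsum g h2] at h3
        rw [Function.update_self]
        refine mul_left_cancel₀ hprime.ne_zero ?_
        linear_combination hh - h3
      · rw [h2 l hl, Function.update_of_ne hl]
  refine ⟨b₁, fun l v => ?_⟩
  rw [hb₁]
  by_cases hl : l = k
  · subst hl
    have : (θ l).1 (X v) = α * (b l).1 (X v) := by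
      simp only [θ, hf', Function.update_self, Submodule.coe_add, Submodule.coe_smul,
        Derivation.add_apply, Derivation.smul_apply, smul_eq_mul]
      ring
    rw [this, Function.update_self, add_comm]
    exact hα1.mul (hb l v)
  · have : (θ l).1 (X v) = (b l).1 (X v) - f l * (b k).1 (X v) := by
      simp [θ, hf', hl, sub_eq_add_neg]
    rw [this, Function.update_of_ne hl]
    exact (hb l v).sub (hfdeg l v)

/-- If all values `θ α` restricted to the hyperplane are multiples of a form `B` of degree
at least that of `b k`, they are multiples of the restriction of `b k α`. -/
theorem exists_homogeneous_multiplier {n : ℕ} {e : Fin n → ℕ}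
    {b : Fin n → Derivation K (MvPolynomial V K) (MvPolynomial V K)}
    (hb : ∀ k, IsHomogeneousDerivation (b k) (e k)) {k : Fin n}
    (hk : ¬ (X i - C c * X j) ∣ b k (X i - C c * X j))
    {B : MvPolynomial {w : V // w ≠ i} K} {d : ℕ} (hB : B.IsHomogeneous d) (hd : e k ≤ d)
    (hdvd : ∀ l, B ∣ restrictHom hij c (b l (X i - C c * X j))) :
    d = e k ∧ ∃ f : Fin n → MvPolynomial V K,
      (∀ l, (X i - C c * X j) ∣ b l (X i - C c * X j) - f l * b k (X i - C c * X j)) ∧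
      ∀ l v, (f l * b k (X v)).IsHomogeneous (e l) := by
  set α : MvPolynomial V K := X i - C c * X j with hα
  have hhom : ∀ l, (restrictHom hij c (b l α)).IsHomogeneous (e l) := fun l =>
    isHomogeneous_restrictHom hij c ((hb l).apply_linear_form i j c)
  have hk0 : restrictHom hij c (b k α) ≠ 0 := fun h =>
    hk ((dvd_iff_restrictHom_eq_zero hij c _).mpr h)
  choose u hu using hdvd
  have hB0 : B ≠ 0 := fun h => hk0 (by rw [hu, h, zero_mul])
  have hu0 : u k ≠ 0 := fun h => hk0 (by rw [hu, h, mul_zero])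
  have hdeg := totalDegree_mul_of_isDomain hB0 hu0
  rw [← hu k, (hhom k).totalDegree hk0, hB.totalDegree hB0] at hdeg
  -- Since `e k ≤ d`, the cofactor of `B` has degree zero, so the restricted `b k α` itself divides
  -- all the others.
  obtain ⟨t, ht⟩ : ∃ t, u k = C t := ⟨_, totalDegree_eq_zero_iff_eq_C.mp (by omega)⟩
  have hde : d = e k := by omega
  have ht0 : t ≠ 0 := by rintro rfl; simp [ht] at hu0
  refine ⟨hde, fun l => if e k ≤ e l then
    rename Subtype.val (C t⁻¹ * homogeneousComponent (e l - e k) (u l)) else 0, fun l => ?_,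
    fun l v => ?_⟩
  · rw [← restrictHom_eq_iff hij, map_mul, hu k, ht]
    have h1 := homogeneousComponent_of_mem (m := e l) (hhom l)
    rw [if_pos rfl, hu l, mul_comm, homogeneousComponent_mul_of_isHomogeneous_right _ hB, hde] at h1
    rw [hu l, mul_comm B, ← h1]
    dsimp only
    split_ifs
    · rw [restrictHom_rename]
      have : (C t⁻¹ * C t : MvPolynomial {w : V // w ≠ i} K) = 1 := by
        rw [← C_mul, inv_mul_cancel₀ ht0, C_1]
      linear_combination
        (-homogeneousComponent (e l - e k) (u l) * B) * this
    · simp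
  · dsimp only
    split_ifs with h
    · have h1 : (rename Subtype.val (C t⁻¹ * homogeneousComponent (e l - e k) (u l)) :
          MvPolynomial V K).IsHomogeneous (e l - e k) :=
        ((homogeneousComponent_isHomogeneous _ _).C_mul _).rename_isHomogeneous
      have h2 := h1.mul (hb k v)
      rwa [Nat.sub_add_cancel h] at h2
    · rw [zero_mul]
      exact isHomogeneous_zero _ _ _

end Addition

theorem zpow_injective_of_forall_pow_ne_one {q : ℂ} (hq : q ≠ 0)
    (hroot : ∀ n : ℕ, 0 < n → q ^ n ≠ 1) {g h : ℤ} (hgh : q ^ g = q ^ h) : g = h := by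
  have key : ∀ g h : ℤ, q ^ g = q ^ h → ¬ g < h := fun g h hgh hlt => by
    refine hroot (h - g).toNat (by omega) ?_
    rw [← zpow_natCast, Int.toNat_of_nonneg (by omega), zpow_sub₀ hq, hgh,
      div_self (zpow_ne_zero _ hq)]
  have h1 := key _ _ hgh
  have h2 := key _ _ hgh.symm
  omega

theorem not_dvd_of_eval {K V : Type*} [Field K] {β α : MvPolynomial V K} (x : V → K)
    (hβ : eval x β = 0) (hα : eval x α ≠ 0) : ¬ β ∣ α := by
  rintro ⟨γ, rfl⟩
  simp [hβ] at hα

/-! ### Deletion, contraction and freeness of bias arrangements -/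

namespace GainGraph

variable {V : Type*} {q : ℂ} {Γ : GainGraph V ℤ} {i j : V} {g : ℤ}

theorem X_sub_dvd_apply_symm (hq : q ≠ 0) (u v : V) (h : ℤ)
    (θ : Derivation ℂ (MvPolynomial V ℂ) (MvPolynomial V ℂ)) :
    (X v - C (q ^ (-h)) * X u) ∣ θ (X v - C (q ^ (-h)) * X u) ↔
      (X u - C (q ^ h) * X v) ∣ θ (X u - C (q ^ h) * X v) := by
  have h0 : q ^ h ≠ 0 := zpow_ne_zero _ hq
  have : (X u - C (q ^ h) * X v : MvPolynomial V ℂ) =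
      C (-(q ^ h)) * (X v - C (q ^ (-h)) * X u) := by
    have : (C (q ^ h) * C (q ^ (-h)) : MvPolynomial V ℂ) = 1 := by
      rw [← C_mul, ← zpow_add₀ hq, add_neg_cancel, zpow_zero, C_1]
    rw [C_neg]
    linear_combination (-X u : MvPolynomial V ℂ) * this
  rw [this, C_mul_dvd_apply_iff (neg_ne_zero.mpr h0)]

theorem mem_logDerivations_iff_delete (hq : q ≠ 0) (he : Γ.Adj i j g)
    (θ : Derivation ℂ (MvPolynomial V ℂ) (MvPolynomial V ℂ)) :
    θ ∈ logDerivations (Γ.biasArrangement q) ↔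
      θ ∈ logDerivations ((Γ.delete i j g).biasArrangement q) ∧
        (X i - C (q ^ g) * X j) ∣ θ (X i - C (q ^ g) * X j) := by
  simp only [mem_logDerivations_biasArrangement]
  refine ⟨fun h => ⟨⟨h.1, fun u v k hk => h.2 u v k hk.1⟩, h.2 i j g he⟩,
    fun ⟨h, hα⟩ => ⟨h.1, fun u v k hk => ?_⟩⟩
  by_cases h1 : u = i ∧ v = j ∧ k = g
  · obtain ⟨rfl, rfl, rfl⟩ := h1
    exact hα
  · by_cases h2 : u = j ∧ v = i ∧ k = -g
    · obtain ⟨rfl, rfl, rfl⟩ := h2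
      exact (X_sub_dvd_apply_symm hq _ _ _ _).mpr hα
    · exact h.2 u v k ⟨hk, h1, h2⟩

theorem restrictDerivation_mem (hq : q ≠ 0) (he : Γ.Adj i j g)
    {θ : Derivation ℂ (MvPolynomial V ℂ) (MvPolynomial V ℂ)}
    (hθ : θ ∈ logDerivations (Γ.biasArrangement q)) :
    restrictDerivation (Γ.ne_of_adj he) (q ^ g) θ ∈
      logDerivations ((Γ.contract i j g).biasArrangement q) := by
  rw [mem_logDerivations_biasArrangement] at hθ ⊢
  have hij := Γ.ne_of_adj he
  have hα := hθ.2 i j g he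
  have key : ∀ β, β ∣ θ β → restrictHom hij (q ^ g) β ∣
      restrictDerivation hij (q ^ g) θ (restrictHom hij (q ^ g) β) := fun β hβ => by
    rw [restrictDerivation_restrictHom hij _ hα]
    exact map_dvd _ hβ
  have hmid : ∀ (u v : {w : V // w ≠ i}) (h' : ℤ), v.1 = j → Γ.Adj u i h' →
      (X u - C (q ^ (h' + g)) * X v) ∣
        restrictDerivation hij (q ^ g) θ (X u - C (q ^ (h' + g)) * X v) := by
    rintro u ⟨v, hv⟩ h' rfl hu
    have := key _ (hθ.2 _ _ _ hu)
    simp only [map_sub, map_mul, restrictHom_X_val, restrictHom_C, restrictHom_X_self] at this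
    simpa only [map_sub, zpow_add₀ hq, C_mul, mul_assoc] using this
  refine ⟨fun w => ?_, ?_⟩
  · simpa using key _ (hθ.1 w.1)
  · rintro u v h ⟨huv, hadj | ⟨hv, h', hu, rfl⟩ | ⟨hu, h', hv, rfl⟩⟩
    · have := key _ (hθ.2 _ _ _ hadj)
      simp only [map_sub, map_mul, restrictHom_X_val, restrictHom_C] at this
      simpa only [map_sub] using this
    · exact hmid u v h' hv hu
    · exact (X_sub_dvd_apply_symm hq _ _ _ _).mpr (hmid v u h' hu hv)

/-- No form of the deletion divides the deleted form, as a suitable point of each hyperplane shows,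
and these forms are prime. For parallel edges this needs distinct gains to have distinct powers of
`q`. -/
theorem mem_logDerivations_of_smul_mem (hq : q ≠ 0) (hroot : ∀ n : ℕ, 0 < n → q ^ n ≠ 1)
    (hij : i ≠ j) {η : Derivation ℂ (MvPolynomial V ℂ) (MvPolynomial V ℂ)}
    (h : (X i - C (q ^ g) * X j : MvPolynomial V ℂ) • η ∈
      logDerivations ((Γ.delete i j g).biasArrangement q)) :
    η ∈ logDerivations ((Γ.delete i j g).biasArrangement q) := by
  classical
  rw [mem_logDerivations_biasArrangement] at h ⊢
  have hg : ∀ k : ℤ, q ^ k ≠ 0 := fun k => zpow_ne_zero k hq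
  refine ⟨fun u => (X_prime.dvd_or_dvd (h.1 u)).resolve_left ?_, fun u v k huv =>
    ((prime_X_sub_C_mul_X ((Γ.delete i j g).ne_of_adj huv) _).dvd_or_dvd
      (h.2 u v k huv)).resolve_left ?_⟩
  · by_cases hu : u = i
    · subst hu
      exact not_dvd_of_eval (Pi.single j 1) (by simp [hij]) (by simp [hij, hg])
    · exact not_dvd_of_eval (Pi.single i 1) (by simp [hu]) (by simp [hij.symm])
  · have huv' := (Γ.delete i j g).ne_of_adj huv
    by_cases hi : i = u ∨ i = v
    · by_cases hj : j = u ∨ j = v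
      · refine not_dvd_of_eval (Pi.single u (q ^ k) + Pi.single v 1)
          (by simp [huv', huv'.symm]) ?_
        rcases hi with rfl | rfl <;> rcases hj with rfl | rfl
        · exact absurd rfl hij
        · have : k ≠ g := fun hk => huv.2.1 ⟨rfl, rfl, hk⟩
          simpa [huv', huv'.symm, sub_eq_zero] using
            fun hk => this (zpow_injective_of_forall_pow_ne_one hq hroot hk)
        · have : k ≠ -g := fun hk => huv.2.2 ⟨rfl, rfl, hk⟩
          have h1 : (1 : ℂ) - q ^ g * q ^ k ≠ 0 := fun h0 => this <| by
            have : g + k = 0 := zpow_injective_of_forall_pow_ne_one hq hroot <| by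
              rw [zpow_add₀ hq, zpow_zero]
              linear_combination -h0
            omega
          simpa [huv', huv'.symm] using h1
        · exact absurd rfl hij
      · push Not at hj
        exact not_dvd_of_eval (Pi.single j 1) (by simp [hj.1.symm, hj.2.symm])
          (by simp [hij, hg])
    · push Not at hi
      exact not_dvd_of_eval (Pi.single i 1) (by simp [hi.1.symm, hi.2.symm]) (by simp [hij.symm])

theorem isFreeWithExponents_of_delete_contract (hq : q ≠ 0)
    (hroot : ∀ n : ℕ, 0 < n → q ^ n ≠ 1) (he : Γ.Adj i j g) {a : ℕ} {d : Multiset ℕ}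
    (hdel : IsFreeWithExponents ((Γ.delete i j g).biasArrangement q) (a ::ₘ d))
    (hcon : IsFreeWithExponents ((Γ.contract i j g).biasArrangement q) d)
    {B : MvPolynomial {w : V // w ≠ i} ℂ} {r : ℕ} (hB : B.IsHomogeneous r) (har : a ≤ r)
    (hdvd : ∀ θ ∈ logDerivations ((Γ.delete i j g).biasArrangement q),
      B ∣ restrictHom (Γ.ne_of_adj he) (q ^ g) (θ (X i - C (q ^ g) * X j))) :
    IsFreeWithExponents (Γ.biasArrangement q) ((a + 1) ::ₘ d) := by
  classical
  obtain ⟨n, e, b, hb, hn⟩ := hdel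
  obtain ⟨n', e', b', hb', hn'⟩ := hcon
  have hij := Γ.ne_of_adj he
  -- The exponents `a ::ₘ d` have exactly one more entry that is at most `a` than `d` does.
  have hcard : Fintype.card {l // e' l ≤ a} < Fintype.card {k // e k ≤ a} := by
    have h1 : ∀ {m : ℕ} (f : Fin m → ℕ), Fintype.card {k // f k ≤ a} =
        Multiset.countP (· ≤ a) (Finset.univ.val.map f) := fun f => by
      rw [Fintype.card_subtype, Multiset.countP_map]
      rfl
    rw [h1, h1, ← hn, ← hn', Multiset.countP_cons_of_pos (p := (· ≤ a)) _ le_rfl]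
    omega
  obtain ⟨k, hka, hk⟩ := exists_generator_not_tangent hij (q ^ g)
    (fun θ => mem_logDerivations_iff_delete hq he θ)
    (fun θ hθ => restrictDerivation_mem hq he hθ)
    (fun η hη => mem_logDerivations_of_smul_mem hq hroot hij hη) b hb b' hb' hcard
  obtain ⟨hrk, f, hf, hfdeg⟩ := exists_homogeneous_multiplier hij (q ^ g) (b := fun l => (b l).1)
    hb hk hB (hka.trans har) fun l => hdvd _ (b l).2
  obtain ⟨b₁, hb₁⟩ := exists_basis_of_addition hij (q ^ g)
    (fun θ => mem_logDerivations_iff_delete hq he θ) b hb hk hf hfdeg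
  have hk_eq : e k = a := by omega
  refine ⟨n, _, b₁, hb₁, ?_⟩
  have hsplit : ∀ f : Fin n → ℕ, Finset.univ.val.map f =
      f k ::ₘ (Finset.univ.erase k).val.map f := fun f => by
    conv_lhs => rw [← Finset.insert_erase (Finset.mem_univ k)]
    rw [Finset.insert_val_of_notMem (Finset.notMem_erase _ _), Multiset.map_cons]
  rw [hsplit, hk_eq, Multiset.cons_inj_right] at hn
  rw [hsplit, Function.update_self, hk_eq, hn]
  congr 1
  refine Multiset.map_congr rfl fun l hl => ?_
  rw [Function.update_of_ne (Finset.ne_of_mem_erase (Finset.mem_val.mp hl))]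

theorem isFreeWithExponents_of_no_edges [Fintype V] (hΓ : ∀ i j g, ¬ Γ.Adj i j g) :
    IsFreeWithExponents (Γ.biasArrangement q) (Multiset.replicate (Fintype.card V) 1) := by
  classical
  have hmem : ∀ θ : Derivation ℂ (MvPolynomial V ℂ) (MvPolynomial V ℂ),
      θ ∈ logDerivations (Γ.biasArrangement q) ↔ ∀ i, X i ∣ θ (X i) := fun θ => by
    rw [mem_logDerivations_biasArrangement]
    exact ⟨fun h => h.1, fun h => ⟨h, fun i j g hg => absurd hg (hΓ i j g)⟩⟩
  let φ := Fintype.equivFin V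
  let θ : Fin (Fintype.card V) → logDerivations (Γ.biasArrangement q) := fun k =>
    ⟨mkDerivation ℂ (Pi.single (φ.symm k) (X (φ.symm k))), (hmem _).mpr fun i => by
      rw [mkDerivation_X]
      by_cases h : i = φ.symm k
      · subst h; simp
      · simp [h]⟩
  have hθ : ∀ k v, (θ k).1 (X v) = if k = φ v then X v else 0 := fun k v => by
    simp only [θ, mkDerivation_X]
    by_cases h : k = φ v
    · subst h; simp
    · rw [if_neg h, Pi.single_eq_of_ne]
      rintro rfl
      simp at h
  obtain ⟨b, hb⟩ := exists_basis_of_existsUnique θ fun x => by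
    choose f hf using (hmem _).mp x.2
    have key : ∀ g : Fin (Fintype.card V) → MvPolynomial V ℂ,
        ∑ l, g l • θ l = x ↔ ∀ v, g (φ v) = f v := fun g => by
      have h1 : ∑ l, g l • θ l = x ↔ ∀ v, g (φ v) * X v = x.1 (X v) := by
        rw [Subtype.ext_iff]
        constructor
        · intro h v
          rw [← h]
          simp only [AddSubmonoidClass.coe_finsetSum, Submodule.coe_smul, derivation_sum_apply,
            Derivation.smul_apply, hθ, smul_eq_mul]
          simp
        · intro h
          refine derivation_ext fun v => ?_
          rw [← h v]
          simp only [AddSubmonoidClass.coe_finsetSum, Submodule.coe_smul, derivation_sum_apply,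
            Derivation.smul_apply, hθ, smul_eq_mul]
          simp
      rw [h1]
      refine forall_congr' fun v => ?_
      rw [hf v, mul_comm, mul_right_inj' (X_ne_zero v)]
    refine ⟨fun k => f (φ.symm k), (key _).mpr fun v => by simp, fun g hg => ?_⟩
    funext k
    simpa using (key g).mp hg (φ.symm k)
  refine ⟨_, fun _ => 1, b, fun k v => ?_, by simp⟩
  rw [hb, hθ]
  split_ifs
  · exact isHomogeneous_X _ _
  · exact isHomogeneous_zero _ _ _

end GainGraph

/-! ### Forms dividing the restricted values -/

section Divisibility

variable {K V : Type*} [Field K] {i j : V} (hij : i ≠ j)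

theorem isRelPrime_X_sub_C_mul_X {u v : V} (huv : u ≠ v) {β : MvPolynomial V K} (c : K)
    (x : V → K) (hx : x u = c * x v) (hβ : eval x β ≠ 0) :
    IsRelPrime (X u - C c * X v) β :=
  (prime_X_sub_C_mul_X huv c).irreducible.isRelPrime_iff_not_dvd.mpr
    (not_dvd_of_eval x (by simp [hx]) hβ)

/-- A derivation tangent to `x j = 0` and to the hyperplanes `x i = c x j` for `c ∈ s` maps the
form of a hyperplane `x i = c₀ x j` to a polynomial whose restriction is divisible by the
power of `x j` with exponent the number of the elements of `s`. -/
theorem X_pow_dvd_restrictHom_apply {c₀ : K} {s : Finset K}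
    {θ : Derivation K (MvPolynomial V K) (MvPolynomial V K)} (hj : X j ∣ θ (X j))
    (hθ : ∀ c ∈ s, (X i - C c * X j) ∣ θ (X i - C c * X j)) :
    X ⟨j, hij.symm⟩ ^ s.card ∣ restrictHom hij c₀ (θ (X i - C c₀ * X j)) := by
  classical
  -- This determinant is unchanged when `X i` is replaced by `X i - C c * X j`, so all the pairwise
  -- coprime forms divide it. On `x i = c₀ x j` it becomes `x j` times the wanted value, and each
  -- form becomes a scalar times `x j`.
  have hdvd : X j * ∏ c ∈ s, (X i - C c * X j) ∣ X j * θ (X i) - X i * θ (X j) := by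
    refine IsRelPrime.mul_dvd ?_ ?_ (Finset.prod_dvd_of_isRelPrime ?_ fun c hc => ?_)
    · refine IsRelPrime.prod_right fun c _ => IsRelPrime.symm ?_
      exact isRelPrime_X_sub_C_mul_X hij c (Pi.single i c + Pi.single j 1)
        (by simp [hij, hij.symm]) (by simp [hij.symm])
    · exact dvd_sub (dvd_mul_right _ _) (hj.mul_left _)
    · intro c _ c' _ hcc
      exact isRelPrime_X_sub_C_mul_X hij c (Pi.single i c + Pi.single j 1)
        (by simp [hij, hij.symm]) (by simpa [hij, hij.symm, sub_eq_zero] using hcc)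
    · have : X j * θ (X i) - X i * θ (X j) =
          X j * θ (X i - C c * X j) - (X i - C c * X j) * θ (X j) := by
        simp
        ring
      rw [this]
      exact dvd_sub ((hθ c hc).mul_left _) (dvd_mul_right _ _)
  have h1 := map_dvd (restrictHom hij c₀) hdvd
  have h2 : restrictHom hij c₀ (X j * θ (X i) - X i * θ (X j)) =
      X ⟨j, hij.symm⟩ * restrictHom hij c₀ (θ (X i - C c₀ * X j)) := by
    simp [restrictHom_X_of_ne hij c₀ hij.symm]
    ring
  have h3 : restrictHom hij c₀ (∏ c ∈ s, (X i - C c * X j)) =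
      C (∏ c ∈ s, (c₀ - c)) * X ⟨j, hij.symm⟩ ^ s.card := by
    rw [map_prod, map_prod, ← Finset.prod_const, ← Finset.prod_mul_distrib]
    refine Finset.prod_congr rfl fun c _ => ?_
    simp [restrictHom_X_of_ne hij c₀ hij.symm]
    ring
  rw [h2, map_mul, h3, restrictHom_X_of_ne hij c₀ hij.symm,
    mul_dvd_mul_iff_left (X_ne_zero _)] at h1
  exact (dvd_mul_left _ _).trans h1

/-- The restriction of `θ (X i - C c * X j)` is divisible by every form that is the common
restriction of two forms tangent to `θ`. -/
theorem X_sub_dvd_restrictHom_apply {c a : K} (ha : a ≠ 0)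
    {θ : Derivation K (MvPolynomial V K) (MvPolynomial V K)} {w : V} (hw : w ≠ i)
    (hwj : (X w - C (a * c) * X j) ∣ θ (X w - C (a * c) * X j))
    (hwi : (X w - C a * X i) ∣ θ (X w - C a * X i)) :
    (X ⟨w, hw⟩ - C (a * c) * X ⟨j, hij.symm⟩) ∣
      restrictHom hij c (θ (X i - C c * X j)) := by
  have h1 := map_dvd (restrictHom hij c) hwj
  have h2 := map_dvd (restrictHom hij c) hwi
  have e1 : restrictHom hij c (X w - C (a * c) * X j) =
      X ⟨w, hw⟩ - C (a * c) * X ⟨j, hij.symm⟩ := by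
    simp [restrictHom_X_of_ne hij c hij.symm, restrictHom_X_of_ne hij c hw]
  have e2 : restrictHom hij c (X w - C a * X i) =
      X ⟨w, hw⟩ - C (a * c) * X ⟨j, hij.symm⟩ := by
    simp [restrictHom_X_of_ne hij c hw, mul_assoc]
  rw [e1] at h1
  rw [e2] at h2
  have h3 : C a * restrictHom hij c (θ (X i - C c * X j)) =
      restrictHom hij c (θ (X w - C (a * c) * X j)) - restrictHom hij c (θ (X w - C a * X i)) := by
    simp
    ring
  have hu : IsUnit (C a : MvPolynomial {w : V // w ≠ i} K) := (IsUnit.mk0 a ha).map C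
  rw [← hu.dvd_mul_left, h3]
  exact dvd_sub h1 h2

end Divisibility

namespace GainGraph

variable {V : Type*} {q : ℂ} {Γ : GainGraph V ℤ} {i j : V} {g : ℤ}

/-- The product of the forms in the restriction to `x i = q ^ g x j` that are known to divide
the restriction of `θ (X i - C (q ^ g) * X j)`. -/
theorem exists_dvd_restrictHom_apply [Fintype V] [DecidableEq V] (hq : q ≠ 0)
    (hroot : ∀ n : ℕ, 0 < n → q ^ n ≠ 1) (hij : i ≠ j) (F : Finset ℤ)
    (hF : ∀ k ∈ F, Γ.Adj i j k) (O : V → Finset ℤ)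
    (hO : ∀ w, w ≠ i → w ≠ j → ∀ h ∈ O w, Γ.Adj w j h ∧ Γ.Adj w i (h - g)) :
    ∃ B : MvPolynomial {w : V // w ≠ i} ℂ, B.IsHomogeneous (1 + F.card +
        ∑ w : {w : {w : V // w ≠ i} // w ≠ ⟨j, hij.symm⟩}, (O w).card) ∧
      ∀ θ ∈ logDerivations (Γ.biasArrangement q),
        B ∣ restrictHom hij (q ^ g) (θ (X i - C (q ^ g) * X j)) := by
  classical
  have hinj : ∀ g h : ℤ, q ^ g = q ^ h → g = h := fun g h =>
    zpow_injective_of_forall_pow_ne_one hq hroot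
  set j' : {w : V // w ≠ i} := ⟨j, hij.symm⟩ with hj'
  refine ⟨X j' ^ (1 + F.card) * ∏ w : {w : {w : V // w ≠ i} // w ≠ j'},
    ∏ h ∈ O w, (X w.1 - C (q ^ h) * X j'), ?_, fun θ hθ => ?_⟩
  · refine (isHomogeneous_X_pow _ _).mul (IsHomogeneous.prod _ _ _ fun w _ => ?_)
    have := IsHomogeneous.prod (O w) (fun h => (X w.1 - C (q ^ h) * X j' : MvPolynomial _ ℂ))
      (fun _ => 1) fun h _ => isHomogeneous_X_sub_C_mul_X _ _ _
    simpa using this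
  · rw [mem_logDerivations_biasArrangement] at hθ
    refine IsRelPrime.mul_dvd ?_ ?_ (Finset.prod_dvd_of_isRelPrime ?_ fun w _ =>
      Finset.prod_dvd_of_isRelPrime ?_ fun h hh => ?_)
    · refine IsRelPrime.pow_left (IsRelPrime.prod_right fun w _ => IsRelPrime.prod_right
        fun h _ => IsRelPrime.symm ?_)
      exact isRelPrime_X_sub_C_mul_X w.2 _ (Pi.single w.1 (q ^ h) + Pi.single j' 1)
        (by simp [w.2, w.2.symm]) (by simp [w.2.symm])
    -- The scalar `0` accounts for the coordinate hyperplane `x i = 0`, whence the exponent `1 +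
    -- F.card`.
    · have := X_pow_dvd_restrictHom_apply hij (c₀ := q ^ g)
        (s := insert 0 (F.image fun k => q ^ k)) (hθ.1 j) ?_
      · rwa [Finset.card_insert_of_notMem, Finset.card_image_of_injective _ fun g h => hinj g h,
          add_comm] at this
        simp only [Finset.mem_image, not_exists, not_and]
        exact fun k _ => zpow_ne_zero k hq
      · simp only [Finset.mem_insert, Finset.mem_image]
        rintro c (rfl | ⟨k, hk, rfl⟩)
        · simpa using hθ.1 i
        · exact hθ.2 i j k (hF k hk)
    · intro w _ w' _ hww
      refine IsRelPrime.prod_left fun h _ => IsRelPrime.prod_right fun h' _ => ?_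
      have hne : w'.1 ≠ w.1 := fun h => hww (Subtype.ext h.symm)
      exact isRelPrime_X_sub_C_mul_X w.2 _ (Pi.single w'.1 1)
        (by simp [hne.symm, w'.2.symm]) (by simp [w'.2.symm])
    · intro h _ h' _ hhh
      exact isRelPrime_X_sub_C_mul_X w.2 _ (Pi.single w.1 (q ^ h) + Pi.single j' 1)
        (by simp [w.2, w.2.symm])
        (by simpa [w.2, w.2.symm, sub_eq_zero] using fun h0 => hhh (hinj _ _ h0))
    · have hwj : w.1.1 ≠ j := fun h => w.2 (Subtype.ext h)
      obtain ⟨h1, h2⟩ := hO w.1.1 w.1.2 hwj h hh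
      have hmul : q ^ (h - g) * q ^ g = q ^ h := by rw [← zpow_add₀ hq, sub_add_cancel]
      have := X_sub_dvd_restrictHom_apply hij (c := q ^ g) (a := q ^ (h - g))
        (zpow_ne_zero _ hq) w.1.2 (θ := θ) (by rw [hmul]; exact hθ.2 _ _ _ h1) (hθ.2 _ _ _ h2)
      rwa [hmul] at this

end GainGraph

/-! ### Arc graphs: lengthening and merging arcs -/

namespace GainGraph

/-- The gain graph with a vertex `v` for every arc of length `L v` on a circle, where the edges
between two arcs of positive lengths encode the forbidden relative positions. -/
def arcGraph {V : Type*} [Fintype V] (L : V → ℕ) : GainGraph V ℤ where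
  Adj u v g := u ≠ v ∧ 0 < L u ∧ 0 < L v ∧ -(L v : ℤ) < g ∧ g < L u
  ne_of_adj h := h.1
  symm h := ⟨h.1.symm, h.2.2.1, h.2.1, by omega, by omega⟩
  finite_vertices := inferInstance
  finite_edges := by
    refine ((Set.finite_univ (α := V)).prod ((Set.finite_univ (α := V)).prod
      (Set.finite_Icc (-((∑ v, L v : ℕ) : ℤ)) (∑ v, L v : ℕ)))).subset ?_
    rintro ⟨u, v, g⟩ ⟨-, -, -, h1, h2⟩
    have hu := Finset.single_le_sum (f := L) (fun _ _ => Nat.zero_le _) (Finset.mem_univ u)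
    have hv := Finset.single_le_sum (f := L) (fun _ _ => Nat.zero_le _) (Finset.mem_univ v)
    simp only at h1 h2
    have hg : g ∈ Set.Icc (-((∑ v, L v : ℕ) : ℤ)) (∑ v, L v : ℕ) := ⟨by omega, by omega⟩
    exact ⟨trivial, trivial, hg⟩

/-- The gain graph `arcGraph L` together with the edges `[i, v, L i]` for `v ∈ S`. -/
def partialArcGraph {V : Type*} [Fintype V] (L : V → ℕ) (i : V) (S : Finset V) :
    GainGraph V ℤ where
  Adj u v g := (arcGraph L).Adj u v g ∨ u ≠ v ∧
    (u = i ∧ v ∈ S ∧ g = L i ∨ v = i ∧ u ∈ S ∧ g = -(L i : ℤ))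
  ne_of_adj := by
    rintro u v g (h | h)
    · exact h.1
    · exact h.1
  symm := by
    rintro u v g (h | ⟨h, ⟨rfl, hv, rfl⟩ | ⟨rfl, hu, rfl⟩⟩)
    · exact Or.inl ((arcGraph L).symm h)
    · exact Or.inr ⟨h.symm, Or.inr ⟨rfl, hv, rfl⟩⟩
    · exact Or.inr ⟨h.symm, Or.inl ⟨rfl, hu, by simp⟩⟩
  finite_vertices := inferInstance
  finite_edges := by
    refine ((arcGraph L).finite_edges.union ((Set.finite_univ (α := V)).prod
      ((Set.finite_univ (α := V)).prod (Set.toFinite {(L i : ℤ), -(L i : ℤ)})))).subset ?_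
    rintro ⟨u, v, g⟩ (h | ⟨-, ⟨-, -, rfl⟩ | ⟨-, -, rfl⟩⟩)
    · exact Or.inl h
    · exact Or.inr ⟨trivial, trivial, Or.inl rfl⟩
    · exact Or.inr ⟨trivial, trivial, Or.inr rfl⟩

@[ext] theorem ext {V G : Type*} [AddGroup G] {Γ Γ' : GainGraph V G}
    (h : ∀ u v g, Γ.Adj u v g ↔ Γ'.Adj u v g) : Γ = Γ' := by
  cases Γ
  cases Γ'
  congr
  funext u v g
  exact propext (h u v g)

variable {V : Type*} [Fintype V] {L : V → ℕ} {i j : V} {S : Finset V}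

theorem partialArcGraph_empty : partialArcGraph L i ∅ = arcGraph L := by
  ext u v g
  simp [partialArcGraph]

variable [DecidableEq V]

/-- Either the arc `i` has positive length, or it is about to be created and all arcs have length
at most one. -/
def Extendable (L : V → ℕ) (i : V) : Prop :=
  0 < L i ∨ ∀ v, L v ≤ 1

/-- For `0 < L i` the only new gain towards `v` is `L i`. For `L i = 0` the gains from `1 - L v` to
`0` all become allowed, and this is the single gain `0` because `L v ≤ 1`. -/
theorem partialArcGraph_full (hL : Extendable L i) :
    partialArcGraph L i (Finset.univ.filter fun v => v ≠ i ∧ 0 < L v) =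
      arcGraph (Function.update L i (L i + 1)) := by
  ext u v g
  simp only [partialArcGraph, arcGraph, Finset.mem_filter, Finset.mem_univ, true_and]
  by_cases huv : u = v
  · simp [huv]
  have hu1 : 0 < L i ∨ L u ≤ 1 := hL.imp id fun h => h u
  have hv1 : 0 < L i ∨ L v ≤ 1 := hL.imp id fun h => h v
  by_cases hu : u = i
  · subst hu
    have hv : v ≠ u := fun h => huv h.symm
    simp only [ne_eq, huv, hv, not_false_eq_true, true_and, false_and, or_false,
      Function.update_self, Function.update_of_ne hv]
    push_cast
    omega
  · by_cases hv : v = i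
    · subst hv
      simp only [ne_eq, huv, not_false_eq_true, true_and, false_and, false_or,
        Function.update_self, Function.update_of_ne hu]
      push_cast
      omega
    · simp [hu, hv]

theorem partialArcGraph_insert_delete (hij : j ≠ i) (hjS : j ∉ S) :
    (partialArcGraph L i (insert j S)).delete j i (-(L i : ℤ)) = partialArcGraph L i S := by
  ext u v g
  simp only [delete, partialArcGraph, arcGraph, Finset.mem_insert, neg_neg]
  constructor
  · rintro ⟨h | ⟨huv, ⟨rfl, rfl | hv, rfl⟩ | ⟨rfl, rfl | hu, rfl⟩⟩, h1, h2⟩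
    · exact Or.inl h
    · simp at h2
    · exact Or.inr ⟨huv, Or.inl ⟨rfl, hv, rfl⟩⟩
    · simp at h1
    · exact Or.inr ⟨huv, Or.inr ⟨rfl, hu, rfl⟩⟩
  · rintro (h | ⟨huv, ⟨rfl, hv, rfl⟩ | ⟨rfl, hu, rfl⟩⟩)
    · refine ⟨Or.inl h, ?_, ?_⟩
      · rintro ⟨rfl, rfl, rfl⟩
        omega
      · rintro ⟨rfl, rfl, rfl⟩
        omega
    · refine ⟨Or.inr ⟨huv, Or.inl ⟨rfl, Or.inr hv, rfl⟩⟩, ?_, ?_⟩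
      · rintro ⟨rfl, rfl, -⟩
        exact hij rfl
      · rintro ⟨-, rfl, -⟩
        exact hjS hv
    · refine ⟨Or.inr ⟨huv, Or.inr ⟨rfl, Or.inr hu, rfl⟩⟩, ?_, ?_⟩
      · rintro ⟨rfl, -, -⟩
        exact hjS hu
      · rintro ⟨rfl, rfl, -⟩
        exact hij rfl

/-- The lengths of the arcs after appending the arc `j` to the arc `i`. -/
def mergeArcs (L : V → ℕ) (i j : V) (w : {w : V // w ≠ j}) : ℕ :=
  if w.1 = i then L i + L j else L w

/-- The gains from `u` to `j`, shifted by `-L i`, fill `-(L i + L j) < h < L u - L i`; those from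
`u` to `i` supply the rest up to `L u`. The gain `-L i` is already among the shifted ones, so the
result does not depend on `S`. -/
theorem partialArcGraph_insert_contract (hij : j ≠ i) (hL : Extendable L i) (hj : 0 < L j)
    (hS : ∀ v ∈ S, v ≠ i ∧ 0 < L v) :
    (partialArcGraph L i (insert j S)).contract j i (-(L i : ℤ)) =
      arcGraph (mergeArcs L i j) := by
  have hmid : ∀ (u : {w : V // w ≠ j}) (h : ℤ), u.1 ≠ i →
      ((partialArcGraph L i (insert j S)).Adj u i h ∨
        (∃ h', (partialArcGraph L i (insert j S)).Adj u j h' ∧ h = h' + -(L i : ℤ)) ↔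
      0 < L u ∧ -((L i + L j : ℕ) : ℤ) < h ∧ h < L u) := by
    rintro ⟨u, huj⟩ h hui
    simp only at hui
    have h1 : (∃ h', (partialArcGraph L i (insert j S)).Adj u j h' ∧ h = h' + -(L i : ℤ)) ↔
        0 < L u ∧ -(L j : ℤ) < h + L i ∧ h + L i < L u := by
      constructor
      · rintro ⟨h', h | ⟨-, ⟨h, -⟩ | ⟨h, -⟩⟩, rfl⟩
        · exact ⟨h.2.1, by have := h.2.2; omega, by have := h.2.2; omega⟩
        · exact absurd h hui
        · exact absurd h hij
      · intro h1
        exact ⟨h + L i, Or.inl ⟨huj, h1.1, hj, h1.2⟩, by ring⟩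
    have h2 : u ∈ S → 0 < L u := fun h => (hS u h).2
    have hu1 : 0 < L i ∨ L u ≤ 1 := hL.imp id fun h => h u
    have hj1 : 0 < L i ∨ L j ≤ 1 := hL.imp id fun h => h j
    rw [h1]
    simp only [partialArcGraph, arcGraph, Finset.mem_insert, ne_eq, hui, huj, not_false_eq_true,
      true_and, false_and, false_or]
    push_cast
    constructor
    · rintro (h | h)
      · by_cases hu : u ∈ S
        · have := h2 hu
          omega
        · simp only [hu, false_and, or_false] at h
          omega
      · omega
    · intro h
      omega
  ext u v h
  change (partialArcGraph L i (insert j S)).ContractAdj j i (-(L i : ℤ)) u v h ↔ _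
  rw [ContractAdj]
  by_cases huv : u = v
  · simp [huv, arcGraph]
  have huv' : u.1 ≠ v.1 := fun h => huv (Subtype.ext h)
  simp only [ne_eq, huv, not_false_eq_true, true_and]
  by_cases hv : v.1 = i
  · have hu : u.1 ≠ i := fun h => huv' (h.trans hv.symm)
    simp only [hv, hu, false_and, or_false, true_and]
    rw [hmid u h hu]
    simp only [arcGraph, mergeArcs, hv, hu, ne_eq, huv, not_false_eq_true, if_true, if_false,
      true_and]
    omega
  · by_cases hu : u.1 = i
    · have h1 := hmid v (-h) hv
      have h2 : (partialArcGraph L i (insert j S)).Adj i v h ↔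
          (partialArcGraph L i (insert j S)).Adj v i (-h) :=
        ⟨fun h => GainGraph.symm _ h, fun h => by simpa using GainGraph.symm _ h⟩
      have h3 : ∀ h', h = -(h' + -(L i : ℤ)) ↔ -h = h' + -(L i : ℤ) := fun h' => by omega
      simp only [hv, hu, false_and, false_or, true_and, h2, h3]
      rw [h1]
      simp only [arcGraph, mergeArcs, hv, hu, ne_eq, huv, not_false_eq_true, if_true, if_false,
        true_and]
      omega
    · simp only [partialArcGraph, arcGraph, mergeArcs, hv, hu, false_and, or_false, ne_eq, huv,
        huv', not_false_eq_true, true_and, and_false, if_false]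

/-- Used with the identity for the total length and with `min · 1` for the number of nonempty arcs.
-/
theorem sum_mergeArcs (f : ℕ → ℕ) (hij : i ≠ j) :
    ∑ w, f (mergeArcs L i j w) + f (L i) + f (L j) = ∑ w, f (L w) + f (L i + L j) := by
  rw [Fintype.sum_eq_add_sum_subtype_ne (fun w => f (L w)) j,
    Fintype.sum_eq_add_sum_subtype_ne (fun w : {w : V // w ≠ j} => f (L w)) ⟨i, hij⟩,
    Fintype.sum_eq_add_sum_subtype_ne (fun w => f (mergeArcs L i j w)) ⟨i, hij⟩]
  have : ∀ w : {w : {w : V // w ≠ j} // w ≠ ⟨i, hij⟩}, mergeArcs L i j w = L w := fun w =>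
    if_neg fun h => w.2 (Subtype.ext h)
  simp only [this]
  simp only [mergeArcs, if_true]
  ring

theorem sum_update_add_one (f : ℕ → ℕ) :
    ∑ w, f (Function.update L i (L i + 1) w) + f (L i) = ∑ w, f (L w) + f (L i + 1) := by
  rw [Fintype.sum_eq_add_sum_subtype_ne (fun w => f (L w)) i,
    Fintype.sum_eq_add_sum_subtype_ne (fun w => f (Function.update L i (L i + 1) w)) i]
  have : ∀ w : {w : V // w ≠ i}, Function.update L i (L i + 1) w = L w := fun w =>
    Function.update_of_ne w.2 _ _
  simp only [this, Function.update_self]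
  ring

end GainGraph

/-! ### Exponents and the induction on total length -/

namespace GainGraph

/-- The exponents of the bias arrangement of the arc graph with `n` vertices, `t` arcs of positive
length, and total length `s`. -/
def arcExponents (n s t : ℕ) : Multiset ℕ :=
  Multiset.replicate (n - (t - 1)) 1 + (Multiset.range (t - 1)).map fun k => s - k

theorem arcExponents_eq_cons_bottom {n s t : ℕ} (ht : 2 ≤ t) :
    arcExponents n s t = (s - (t - 2)) ::ₘ arcExponents (n - 1) s (t - 1) := by
  obtain ⟨t, rfl⟩ := Nat.exists_eq_add_of_le' ht
  simp only [arcExponents, Nat.add_sub_cancel, show t + 2 - 1 = t + 1 by omega,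
    Multiset.range_succ, Multiset.map_cons, Multiset.add_cons,
    show n - 1 - t = n - (t + 1) by omega]

/-- Removing the largest exponent at total length `s + 1` leaves the same multiset as removing the
smallest of the `t - 1` distinguished exponents at `s`: the exponents of the merged arcs. -/
theorem arcExponents_eq_cons_top {n s t : ℕ} (ht : 2 ≤ t) :
    arcExponents n (s + 1) t = (s + 1) ::ₘ arcExponents (n - 1) s (t - 1) := by
  obtain ⟨t, rfl⟩ := Nat.exists_eq_add_of_le' ht
  simp only [arcExponents, Nat.add_sub_cancel, show t + 2 - 1 = t + 1 by omega,
    show n - 1 - t = n - (t + 1) by omega]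
  rw [← Multiset.coe_range, List.range_succ_eq_map, ← Multiset.cons_coe, Multiset.map_cons,
    Multiset.add_cons, Nat.sub_zero, ← Multiset.map_coe, Multiset.map_map, Multiset.coe_range]
  congr 3
  funext k
  simp

theorem arcExponents_eq_one_cons {n s t : ℕ} (ht : t ≤ n) (ht' : 1 ≤ t) :
    arcExponents n s (t - 1) = 1 ::ₘ arcExponents (n - 1) s (t - 1) := by
  simp only [arcExponents]
  rw [show n - (t - 1 - 1) = (n - 1 - (t - 1 - 1)) + 1 by omega, Multiset.replicate_succ,
    Multiset.cons_add]

theorem arcExponents_of_le_one {n s t : ℕ} (ht : t ≤ 1) :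
    arcExponents n s t = Multiset.replicate n 1 := by
  simp [arcExponents, Nat.sub_eq_zero_of_le ht]

variable {V : Type} [Fintype V] [DecidableEq V] {L : V → ℕ} {i : V} {q : ℂ}

/-- The exponent that grows while the edges of `partialArcGraph L i` are added. -/
def growingExponent (L : V → ℕ) (i : V) : ℕ :=
  if L i = 0 then 1 else 2 + ∑ v, (L v - 1)

theorem partialArcGraph_inductivelyFree_and_free (hq : q ≠ 0)
    (hroot : ∀ n : ℕ, 0 < n → q ^ n ≠ 1)
    (hL : Extendable L i) {d : Multiset ℕ}
    (hcon : ∀ j, j ≠ i → 0 < L j →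
      BiasInductivelyFreeAlongEdges q (arcGraph (mergeArcs L i j)) ∧
        IsFreeWithExponents ((arcGraph (mergeArcs L i j)).biasArrangement q) d)
    (h0 : BiasInductivelyFreeAlongEdges q (arcGraph L) ∧
      IsFreeWithExponents ((arcGraph L).biasArrangement q) (growingExponent L i ::ₘ d))
    (S : Finset V) (hS : ∀ v ∈ S, v ≠ i ∧ 0 < L v) :
    BiasInductivelyFreeAlongEdges q (partialArcGraph L i S) ∧
      IsFreeWithExponents ((partialArcGraph L i S).biasArrangement q)
        ((growingExponent L i + S.card) ::ₘ d) := by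
  induction S using Finset.induction_on with
  | empty => simpa [partialArcGraph_empty] using h0
  | insert j S hjS ih =>
    obtain ⟨hji, hj⟩ := hS j (Finset.mem_insert_self _ _)
    have hS' : ∀ v ∈ S, v ≠ i ∧ 0 < L v := fun v hv => hS v (Finset.mem_insert_of_mem hv)
    obtain ⟨hind, hfree⟩ := ih hS'
    obtain ⟨hcind, hcfree⟩ := hcon j hji hj
    have hadj : (partialArcGraph L i (insert j S)).Adj j i (-(L i : ℤ)) :=
      Or.inr ⟨hji, Or.inr ⟨rfl, Finset.mem_insert_self _ _, rfl⟩⟩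
    have hdel := partialArcGraph_insert_delete (L := L) hji hjS
    have hctr := partialArcGraph_insert_contract hji hL hj hS'
    refine ⟨.of_edge _ j i (-(L i : ℤ)) hadj (hdel ▸ hind) (hctr ▸ hcind)
      (hdel ▸ hctr ▸ ⟨d, _, hcfree, hfree, Multiset.le_cons_self _ _⟩), ?_⟩
    -- `F` lists the gains of the edges parallel to the new one. `O w` lists the gains `h` for which
    -- `[w, i, h]` and `[w, j, h + L i]` are both present, so that the two hyperplanes have the same
    -- restriction; `-L i` occurs only if `[i, w, L i]` was added already.
    let F : Finset ℤ := if L i = 0 then ∅ else Finset.Ioo (-(L i : ℤ)) (L j)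
    let O : V → Finset ℤ := fun w =>
      Finset.Ioo (-(L i : ℤ)) (L w - L i) ∪ if w ∈ S then {-(L i : ℤ)} else ∅
    have hOcard : ∀ w, (O w).card = L w - 1 + if w ∈ S then 1 else 0 := fun w => by
      rw [Finset.card_union_of_disjoint, Int.card_Ioo]
      · split_ifs <;> simp
      · split_ifs <;> simp
    obtain ⟨B, hB, hdvd⟩ := exists_dvd_restrictHom_apply (Γ := partialArcGraph L i S)
      (g := -(L i : ℤ)) hq hroot hji F
      (fun k hk => by
        simp only [F] at hk
        split_ifs at hk with h
        · simp at hk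
        · rw [Finset.mem_Ioo] at hk
          exact Or.inl ⟨hji, hj, by omega, hk.1, hk.2⟩)
      O
      (fun w hwj hwi h hh => by
        have hw1 : 0 < L i ∨ L w ≤ 1 := hL.imp id fun h => h w
        simp only [O, Finset.mem_union, Finset.mem_Ioo] at hh
        rcases hh with hh | hh
        · exact ⟨Or.inl ⟨hwi, by omega, by omega, by omega, by omega⟩,
            Or.inl ⟨hwj, by omega, hj, by omega, by omega⟩⟩
        · split_ifs at hh with hwS
          · rw [Finset.mem_singleton] at hh
            subst hh
            have := (hS' w hwS).2
            exact ⟨Or.inr ⟨hwi, Or.inr ⟨rfl, hwS, rfl⟩⟩,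
              Or.inl ⟨hwj, this, hj, by omega, by omega⟩⟩
          · simp at hh)
    -- If `0 < L i`, then `1 + F.card = 2 + (L i - 1) + (L j - 1)`, and each other `w` contributes
    -- `L w - 1`, plus one if `w ∈ S`. Truncated subtraction makes empty arcs contribute nothing.
    have hdeg : growingExponent L i + S.card ≤ 1 + F.card +
        ∑ w : {w : {w : V // w ≠ j} // w ≠ ⟨i, hji.symm⟩}, (O w).card := by
      have h1 : ∀ f : V → ℕ, ∑ w, f w =
          f j + (f i + ∑ w : {w : {w : V // w ≠ j} // w ≠ ⟨i, hji.symm⟩}, f w) := fun f => by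
        rw [Fintype.sum_eq_add_sum_subtype_ne f j,
          Fintype.sum_eq_add_sum_subtype_ne (fun w : {w : V // w ≠ j} => f w) ⟨i, hji.symm⟩]
      have h2 := h1 fun w => L w - 1
      have h3 := h1 fun w => if w ∈ S then 1 else 0
      have hiS : i ∉ S := fun h => (hS' i h).1 rfl
      simp only [hjS, hiS, if_false, Finset.sum_boole, Finset.filter_univ_mem, Nat.cast_id,
        zero_add] at h3
      simp only [hOcard, Finset.sum_add_distrib]
      simp only [Finset.sum_boole, Nat.cast_id] at h3 ⊢
      rw [← h3]
      simp only [growingExponent, F]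
      split_ifs with h
      · omega
      · rw [Int.card_Ioo, h2]
        omega
    have := isFreeWithExponents_of_delete_contract hq hroot hadj (hdel.symm ▸ hfree)
      (hctr.symm ▸ hcfree) hB hdeg (hdel.symm ▸ hdvd)
    rwa [Finset.card_insert_of_notMem hjS, ← add_assoc]

theorem arcGraph_inductivelyFree_and_free (hq : q ≠ 0) (hroot : ∀ n : ℕ, 0 < n → q ^ n ≠ 1)
    (s : ℕ) : ∀ {V : Type} [Fintype V] (L : V → ℕ), ∑ v, L v = s →
      BiasInductivelyFreeAlongEdges q (arcGraph L) ∧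
        IsFreeWithExponents ((arcGraph L).biasArrangement q)
          (arcExponents (Fintype.card V) s (∑ v, min (L v) 1)) := by
  induction s with
  | zero =>
    intro V _ L hL
    have hL0 : ∀ v, L v = 0 := by simpa using hL
    have hno : ∀ i j g, ¬ (arcGraph L).Adj i j g := fun i j g h => by
      have := h.2.1
      simp [hL0] at this
    refine ⟨.of_no_edges _ hno, ?_⟩
    rw [arcExponents_of_le_one (by simp [hL0])]
    exact isFreeWithExponents_of_no_edges hno
  | succ s ih =>
    intro V _ L' hL'
    classical
    -- An arc is removed entirely only when no arc is longer than one, as `Extendable` demands.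
    obtain ⟨i, hi, hext⟩ : ∃ i, 0 < L' i ∧ (1 < L' i ∨ ∀ v, L' v ≤ 1) := by
      by_cases h : ∃ i, 1 < L' i
      · obtain ⟨i, hi⟩ := h
        exact ⟨i, by omega, Or.inl hi⟩
      · push Not at h
        have : ∑ v, L' v ≠ 0 := by omega
        obtain ⟨i, -, hi⟩ := Finset.exists_ne_zero_of_sum_ne_zero this
        exact ⟨i, by omega, Or.inr h⟩
    obtain ⟨L, hLi, rfl⟩ : ∃ L : V → ℕ, Extendable L i ∧ L' = Function.update L i (L i + 1) := by
      refine ⟨Function.update L' i (L' i - 1), ?_, ?_⟩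
      · rcases hext with h | h
        · exact Or.inl (by simpa using h)
        · refine Or.inr fun v => ?_
          by_cases hv : v = i
          · subst hv
            have := h v
            simp
            omega
          · simpa [hv] using h v
      · simp [Nat.sub_add_cancel hi]
    have hs : ∑ w, Function.update L i (L i + 1) w + L i = ∑ w, L w + (L i + 1) :=
      sum_update_add_one id
    have ht : ∑ w, min (Function.update L i (L i + 1) w) 1 + min (L i) 1 =
        ∑ w, min (L w) 1 + min (L i + 1) 1 := sum_update_add_one fun a => min a 1
    have hst : ∑ v, L v = ∑ v, (L v - 1) + ∑ v, min (L v) 1 := by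
      rw [← Finset.sum_add_distrib]
      exact Finset.sum_congr rfl fun v _ => by omega
    have hfull : (Finset.univ.filter fun v => v ≠ i ∧ 0 < L v).card + 1 =
        ∑ w, min (Function.update L i (L i + 1) w) 1 := by
      have h1 : (Finset.univ.filter fun v => v ≠ i ∧ 0 < L v) =
          (Finset.univ.filter fun v => 0 < Function.update L i (L i + 1) v).erase i := by
        ext v
        by_cases hv : v = i <;> simp [hv]
      rw [h1, Finset.card_erase_add_one (by simp), Finset.card_filter]
      exact Finset.sum_congr rfl fun v _ => by split_ifs <;> omega
    set t := ∑ w, min (Function.update L i (L i + 1) w) 1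
    have hLs : ∑ v, L v = s := by omega
    have htn : t ≤ Fintype.card V := by
      rw [← hfull, ← Finset.card_univ]
      refine Finset.card_lt_card (Finset.filter_ssubset.mpr ⟨i, Finset.mem_univ _, by simp⟩)
    obtain ⟨hind, hfree⟩ := ih L hLs
    rw [← partialArcGraph_full hLi]
    rcases Nat.lt_or_ge t 2 with ht2 | ht2
    · have hempty : (Finset.univ.filter fun v => v ≠ i ∧ 0 < L v) = ∅ :=
        Finset.card_eq_zero.mp (by omega)
      rw [hempty, partialArcGraph_empty, arcExponents_of_le_one (by omega)]
      rw [arcExponents_of_le_one (by omega)] at hfree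
      exact ⟨hind, hfree⟩
    · have hcon : ∀ j, j ≠ i → 0 < L j →
          BiasInductivelyFreeAlongEdges q (arcGraph (mergeArcs L i j)) ∧
          IsFreeWithExponents ((arcGraph (mergeArcs L i j)).biasArrangement q)
            (arcExponents (Fintype.card V - 1) s (t - 1)) := fun j hj hLj => by
        have h1 : ∑ w, mergeArcs L i j w + L i + L j = ∑ w, L w + (L i + L j) :=
          sum_mergeArcs id hj.symm
        have h2 : ∑ w, min (mergeArcs L i j w) 1 + min (L i) 1 + min (L j) 1 =
            ∑ w, min (L w) 1 + min (L i + L j) 1 := sum_mergeArcs (fun a => min a 1) hj.symm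
        have := ih (mergeArcs L i j) (by omega)
        rwa [show ∑ v, min (mergeArcs L i j v) 1 = t - 1 by omega,
          show Fintype.card {w : V // w ≠ j} = Fintype.card V - 1 by
            simp [Fintype.card_subtype_compl]] at this
      -- For a new arc the growing exponent is one of the ones; otherwise it is `s - (t - 2)`.
      have hold : arcExponents (Fintype.card V) s (∑ v, min (L v) 1) =
          growingExponent L i ::ₘ arcExponents (Fintype.card V - 1) s (t - 1) := by
        rw [growingExponent]
        split_ifs with h
        · rw [show ∑ v, min (L v) 1 = t - 1 by omega]
          exact arcExponents_eq_one_cons htn (by omega)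
        · rw [show ∑ v, min (L v) 1 = t by omega, arcExponents_eq_cons_bottom ht2]
          congr 1
          omega
      have hgrow : growingExponent L i +
          (Finset.univ.filter fun v => v ≠ i ∧ 0 < L v).card = s + 1 := by
        rw [growingExponent]
        split_ifs with h
        · have hz : ∑ v, (L v - 1) = 0 := by
            refine Finset.sum_eq_zero fun v _ => ?_
            have := (hLi.resolve_left (by omega)) v
            omega
          omega
        · omega
      have := partialArcGraph_inductivelyFree_and_free hq hroot hLi hcon
        ⟨hind, hold ▸ hfree⟩ (S := Finset.univ.filter fun v => v ≠ i ∧ 0 < L v)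
        (fun v hv => (Finset.mem_filter.mp hv).2)
      rwa [hgrow, ← arcExponents_eq_cons_top ht2] at this

theorem catalanGainGraph_eq_arcGraph (ℓ m : ℕ) :
    catalanGainGraph ℓ m = arcGraph fun _ : Fin ℓ => m + 1 := by
  ext u v g
  simp only [catalanGainGraph, arcGraph]
  push_cast
  refine and_congr_right fun _ => ?_
  omega

theorem arcExponents_catalan {ℓ : ℕ} (hℓ : 1 ≤ ℓ) (m : ℕ) :
    arcExponents ℓ (ℓ * (m + 1)) ℓ = 1 ::ₘ (Finset.Icc 2 ℓ).val.map fun k => m * ℓ + k := by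
  rw [arcExponents, Nat.sub_sub_self hℓ, Multiset.replicate_one, Multiset.singleton_add]
  congr 1
  have : (Finset.Icc 2 ℓ) = (Finset.range (ℓ - 1)).image fun k => ℓ - k := by
    ext k
    simp only [Finset.mem_Icc, Finset.mem_image, Finset.mem_range]
    exact ⟨fun h => ⟨ℓ - k, by omega, by omega⟩, fun ⟨a, ha, hk⟩ => by omega⟩
  rw [this, Finset.image_val_of_injOn, Multiset.map_map, Finset.range_val]
  · refine Multiset.map_congr rfl fun k hk => ?_
    rw [Multiset.mem_range] at hk
    have : ℓ * (m + 1) = m * ℓ + ℓ := by ring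
    simp only [Function.comp_apply]
    omega
  · intro a ha b hb hab
    simp only [Finset.coe_range, Set.mem_Iio] at ha hb hab
    omega

end GainGraph

end

theorem corollary3p1 (ℓ m : ℕ) (hℓ : 1 ≤ ℓ) (q : ℂ) (hq : q ≠ 0)
    (hroot : ∀ n : ℕ, 0 < n → q ^ n ≠ 1) :
    arrangementOfPolynomial (fussCatalanPolynomial q ℓ m) =
        (catalanGainGraph ℓ m).biasArrangement q ∧
      BiasInductivelyFreeAlongEdges q (catalanGainGraph ℓ m) ∧
      IsFreeWithExponents (arrangementOfPolynomial (fussCatalanPolynomial q ℓ m))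
        (1 ::ₘ (Finset.Icc 2 ℓ).val.map fun k => m * ℓ + k) := by
  have harr := arrangementOfPolynomial_fussCatalanPolynomial ℓ m hq
  obtain ⟨hind, hfree⟩ := GainGraph.arcGraph_inductivelyFree_and_free hq hroot (ℓ * (m + 1))
    (fun _ : Fin ℓ => m + 1) (by simp)
  rw [← GainGraph.catalanGainGraph_eq_arcGraph] at hind hfree
  refine ⟨harr, hind, ?_⟩
  rw [harr, ← GainGraph.arcExponents_catalan hℓ]
  simpa using hfree
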